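/- **Lemma (common sequences).** *Setting.* Let $\log^* n$ be the least $k\ge 0$ such that the $k$-fold iterated binary logarithm of $n$ is at most $1$. For $W\ge 0$, a $W$-colored sequence is a finite sequence over $\{0,\dots,W\}$ whose adjacent entries differ. Put $\Delta_L=\log^*W+6$, $\Delta_R=4$, and let $f:[-1..W]^{\log^*W+11}\to\{0,1\}$ be any locally consistent parsing function for $W$-colored sequences: for each such sequence $p$ of length $n$, extended by $-1$ outside of $p$, the bits $d[i]=f(\tilde p[i-\Delta_L],\dots,\tilde p[i+\Delta_R])$ satisfy $d[1]=1$, and cutting $p$ in front of every position with $d[i]=1$ yields, if $n\ge 2$, blocks of length $2$, $3$ or $4$. Write $\mathrm{Eblock}(p)$ for the sequence of these blocks, and $\mathrm{Epow}(s)$ for the sequence of maximal runs $a^r$ ($r\ge1$) of equal entries of a sequence $s$; $|\mathrm{Epow}(s)|$ is the number of these runs. A run-length grammar has a finite set $\mathcal V$ of positive integers as variables (signatures), and for each $e\in\mathcal V$ exactly one production $e\to a$ (a character), $e\to e_\ell e_r$, or $e\to\hat e^{\,k}$ with $k\ge 1$, where $e_\ell,e_r,\hat e\in\mathcal V$ are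 smaller than $e$; distinct variables have distinct right-hand sides. $\mathrm{Sig}(x)$ is the variable with right-hand side $x$; for a block of three or four variables it is obtained by combining them pairwise from left to right; $\mathrm{Sig}^+$ applies $\mathrm{Sig}$ entrywise. $\mathrm{val}(e)$ is the string derived by $e$, and $\mathrm{val}^+(e_1\cdots e_d)=\mathrm{val}(e_1)\cdots\mathrm{val}(e_d)$. For a nonempty string $T$ let $\mathrm{Shrink}_0=\mathrm{Sig}^+(T)$, $\mathrm{Pow}_t=\mathrm{Sig}^+(\mathrm{Epow}(\mathrm{Shrink}_t))$, $\mathrm{Shrink}_{t+1}=\mathrm{Sig}^+(\mathrm{Eblock}(\mathrm{Pow}_t))$, and let $\mathrm{id}(T)$ be the only entry of $\mathrm{Pow}_h$ for the least $h$ with $|\mathrm{Pow}_h|=1$. The grammar is the *signature encoding* of a text $T$ if its variables are at most $W$, $\mathrm{id}(T)$ is defined, and every variable other than the start symbol $\mathrm{id}(T)$ is used in a production. More generally, it is the signature encoding of a set $\mathcal T$ of texts if its variables are at most $W$, $\mathrm{id}(T)$ is defined for every $T\in\mathcal T$, and every variable other than these $\mathrm{id}(T)$ is used in a production; the case of a single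 text is $\mathcal T=\{T\}$. A variable $x$ occurs at position $c$ in $e$ if the derivation tree of $e$ has a node labeled $x$ the leftmost leaf below which is the $c$-th leaf of the tree; a sequence $v$ occurs at position $c$ in $e$ if each $v[j]$ occurs at position $c+|\mathrm{val}^+(v[1..j-1])|$ in $e$. *Claim.* For every constant $K$ there is a constant $C$ such that the following holds for all alphabets and all $M$, $W\le K M$ and $f$ as above. Let $\mathcal G$ be the signature encoding of a set $\mathcal T$ of texts of length at most $M$, with set of signatures $\mathcal V$, and let $P$ be any nonempty string that is a substring of some $T\in\mathcal T$. Then there is a sequence $v$ of signatures from $\mathcal V$ such that 1. $\mathrm{val}^+(v)=P$; 2. $|\mathrm{Epow}(v)|\le C\,\log_2|P|\,\log^*M$ if $|P|\ge 2$ (if $|P|=1$, then $v$ is a single signature by (1)); 3. for every $e\in\mathcal V$ and every $i$ with $\mathrm{val}(e)[i..i+|P|-1]=P$, the sequence $v$ occurs at position $i$ in $e$. -/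

import Mathlib

universe u

namespace SigEnc

/-! ### Iterated logarithm -/

/-- `logStar n` is the least `k` such that the `k`-fold iterated binary logarithm of `n` is at
most `1`. -/
noncomputable def logStar (n : ℕ) : ℕ := sInf {k : ℕ | (Real.logb 2)^[k] (n : ℝ) ≤ 1}

/-- The tower `2 ^ 2 ^ ⋯ ^ 2` of height `k`. -/
def tower : ℕ → ℕ
  | 0 => 1
  | k + 1 => 2 ^ tower k

theorem le_tower_of_iterate (k : ℕ) : ∀ x : ℝ, (Real.logb 2)^[k] x ≤ 1 → x ≤ tower k := by
  induction k with
  | zero => intro x hx; simpa [tower] using hx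
  | succ k ih =>
    intro x hx
    rw [Function.iterate_succ_apply] at hx
    have h := ih _ hx
    rcases le_or_gt x 0 with h0 | h0
    · exact h0.trans (Nat.cast_nonneg _)
    · rw [Real.logb_le_iff_le_rpow (by norm_num) h0, Real.rpow_natCast] at h
      simpa [tower] using h

theorem exists_iterate_of_le_tower (k : ℕ) :
    ∀ x : ℝ, x ≤ tower k → ∃ j ≤ k, (Real.logb 2)^[j] x ≤ 1 := by
  induction k with
  | zero => intro x hx; exact ⟨0, le_rfl, by simpa [tower] using hx⟩
  | succ k ih =>
    intro x hx
    rcases le_or_gt x 1 with h1 | h1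
    · exact ⟨0, Nat.zero_le _, h1⟩
    · have h : Real.logb 2 x ≤ tower k := by
        rw [Real.logb_le_iff_le_rpow (by norm_num) (by linarith), Real.rpow_natCast]
        simpa [tower] using hx
      obtain ⟨j, hj, hj'⟩ := ih _ h
      exact ⟨j + 1, by omega, by rwa [Function.iterate_succ_apply]⟩

theorem lt_tower (n : ℕ) : n < tower n := by
  induction n with
  | zero => simp [tower]
  | succ n ih => 
    have : tower n < 2 ^ tower n := Nat.lt_two_pow_self
    simp only [tower]; omega

theorem tower_mono : Monotone tower :=
  monotone_nat_of_le_succ fun _ => Nat.lt_two_pow_self.le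

/-- `logStar n` is also the height of the least tower of twos which is at least `n`. -/
theorem logStar_le_iff (n k : ℕ) : logStar n ≤ k ↔ n ≤ tower k := by
  have hne : {k : ℕ | (Real.logb 2)^[k] (n : ℝ) ≤ 1}.Nonempty := by
    obtain ⟨j, _, hj⟩ := exists_iterate_of_le_tower n n (by exact_mod_cast (lt_tower n).le)
    exact ⟨j, hj⟩
  constructor
  · intro h
    have h1 : (Real.logb 2)^[logStar n] (n : ℝ) ≤ 1 := Nat.sInf_mem hne
    have h2 := le_tower_of_iterate _ _ h1
    exact (by exact_mod_cast h2 : n ≤ tower (logStar n)).trans (tower_mono h)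
  · intro h
    obtain ⟨j, hj, hj'⟩ := exists_iterate_of_le_tower k n (by exact_mod_cast h)
    exact (Nat.sInf_le hj').trans hj

/-! ### Runs, blocks and locally consistent parsing

All positions are counted from `0`. -/

/-- The maximal runs of equal entries of `s`, from left to right, a run `a ^ r` being
written `(a, r)`. -/
def encpow (s : List ℕ) : List (ℕ × ℕ) :=
  (s.splitBy (fun a b => a == b)).map (fun q => (q.headD 0, q.length))

/-- The bit at position `i` which the local rule `f` computes for the sequence `p`, from the
entries at positions `i - ΔL, …, i + ΔR`, where `ΔL = log* W + 6` and `ΔR = 4`;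
`none` stands for the symbol `-1` outside of `p`. -/
noncomputable def bit {W : ℕ} (f : (Fin (logStar W + 11) → Option ℕ) → Bool)
    (p : List ℕ) (i : ℕ) : Bool :=
  f (fun k => if logStar W + 6 ≤ i + k then p[i + k - (logStar W + 6)]? else none)

/-- `p` is cut in front of every position with bit `true`; the resulting factors are
the blocks of `p`. -/
noncomputable def eblock {W : ℕ} (f : (Fin (logStar W + 11) → Option ℕ) → Bool)
    (p : List ℕ) : List (List ℕ) :=
  ((p.zip ((List.range p.length).map (bit f p))).splitBy (fun _ y => !y.2)).map
    (fun q => q.map Prod.fst)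

/-- Sequences with entries in `[0..W]` whose adjacent entries differ. -/
def IsColored (W : ℕ) (p : List ℕ) : Prop :=
  p.IsChain (fun a b => a ≠ b) ∧ ∀ a ∈ p, a ≤ W

/-- The local rule `f` is a locally consistent parsing of the `W`-colored sequences: position `0`
starts a block, and every block of a sequence of length at least `2` has length `2`, `3` or `4`
(no two adjacent bits are `true`, among four consecutive bits one is `true`, the last bit
is `false`). -/
def IsLocallyConsistent (W : ℕ) (f : (Fin (logStar W + 11) → Option ℕ) → Bool) : Prop :=
  ∀ p : List ℕ, IsColored W p →
    (0 < p.length → bit f p 0 = true) ∧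
    (∀ i, i + 1 < p.length → ¬ (bit f p i = true ∧ bit f p (i + 1) = true)) ∧
    (∀ i, i + 3 < p.length → bit f p i = true ∨ bit f p (i + 1) = true ∨
      bit f p (i + 2) = true ∨ bit f p (i + 3) = true) ∧
    (2 ≤ p.length → bit f p (p.length - 1) = false)

/-! ### Existence of a locally consistent parsing

Deterministic coin tossing: the colors are reduced to six, then to three, and the local maxima
start the blocks. -/

theorem toNat_inj {a b : Bool} (h : a.toNat = b.toNat) : a = b := by
  cases a <;> cases b <;> simp_all

/-- `2 i + b`, where `i` is the lowest binary digit in which `a` and `c` differ and `b` is this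
digit of `c`. -/
noncomputable def toss (a c : ℕ) : ℕ :=
  2 * sInf {i | a.testBit i ≠ c.testBit i} + (c.testBit (sInf {i | a.testBit i ≠ c.testBit i})).toNat

theorem toss_spec {a c : ℕ} (h : a ≠ c) :
    a.testBit (toss a c / 2) ≠ c.testBit (toss a c / 2) ∧
      toss a c = 2 * (toss a c / 2) + (c.testBit (toss a c / 2)).toNat := by
  have hne : {i | a.testBit i ≠ c.testBit i}.Nonempty := by
    by_contra hc
    rw [Set.not_nonempty_iff_eq_empty] at hc
    refine h (Nat.eq_of_testBit_eq fun i => ?_)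
    by_contra hi
    have : i ∈ {i | a.testBit i ≠ c.testBit i} := hi
    rw [hc] at this
    exact this
  have h1 := Nat.sInf_mem hne
  have h2 : toss a c / 2 = sInf {i | a.testBit i ≠ c.testBit i} := by
    have := Bool.toNat_le (c.testBit (sInf {i | a.testBit i ≠ c.testBit i}))
    unfold toss
    omega
  rw [h2]
  exact ⟨h1, rfl⟩

theorem toss_lt {a c m : ℕ} (h : a ≠ c) (ha : a < 2 ^ m) (hc : c < 2 ^ m) : toss a c < 2 * m := by
  obtain ⟨h1, h2⟩ := toss_spec h
  have h3 : toss a c / 2 < m := by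
    by_contra hm
    have hp : 2 ^ m ≤ 2 ^ (toss a c / 2) := Nat.pow_le_pow_right (by norm_num) (by omega)
    rw [Nat.testBit_lt_two_pow (ha.trans_le hp), Nat.testBit_lt_two_pow (hc.trans_le hp)] at h1
    exact h1 rfl
  omega

theorem toss_ne {a b c : ℕ} (hab : a ≠ b) (hbc : b ≠ c) : toss a b ≠ toss b c := by
  intro h
  obtain ⟨-, h2⟩ := toss_spec hab
  obtain ⟨h3, h4⟩ := toss_spec hbc
  rw [h] at h2
  exact h3 (toNat_inj (by omega))

/-- The colors after `k` rounds of coin tossing. -/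
noncomputable def tosses (p : List ℕ) : ℕ → ℕ → ℕ
  | 0, i => p.getD i 0
  | k + 1, 0 => (tosses p k 0).testBit 0 |>.toNat
  | k + 1, i + 1 => toss (tosses p k i) (tosses p k (i + 1))

theorem tosses_ne {W : ℕ} {p : List ℕ} (hp : IsColored W p) (k : ℕ) :
    ∀ i, i + 1 < p.length → tosses p k i ≠ tosses p k (i + 1) := by
  induction k with
  | zero =>
    intro i hi
    have := List.isChain_iff_getElem.1 hp.1 i hi
    simp only [tosses]
    rwa [List.getD_eq_getElem _ _ hi, List.getD_eq_getElem _ _ (Nat.lt_of_succ_lt hi)]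
  | succ k ih =>
    intro i hi
    cases i with
    | zero =>
      intro h
      obtain ⟨h1, h2⟩ := toss_spec (ih 0 hi)
      simp only [tosses] at h
      have h3 := Bool.toNat_le ((tosses p k 0).testBit 0)
      have h4 : toss (tosses p k 0) (tosses p k (0 + 1)) / 2 = 0 := by omega
      rw [h4] at h1 h2
      exact h1 (toNat_inj (by omega))
    | succ i => exact toss_ne (ih i (by omega)) (ih (i + 1) hi)

theorem tosses_le {W : ℕ} {p : List ℕ} (hp : IsColored W p) (k : ℕ) :
    ∀ m, W ≤ 2 * tower (m + k) + 3 → ∀ i < p.length, tosses p k i ≤ 2 * tower m + 3 := by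
  induction k with
  | zero =>
    intro m hm i hi
    simp only [tosses, List.getD_eq_getElem _ _ hi]
    exact (hp.2 _ (List.getElem_mem hi)).trans hm
  | succ k ih =>
    intro m hm i hi
    have h := ih (m + 1) (by rwa [show m + 1 + k = m + (k + 1) by omega])
    have hb : ∀ j < p.length, tosses p k j < 2 ^ (tower m + 2) := by
      intro j hj
      have h1 := h j hj
      have h2 : 2 ^ 1 ≤ 2 ^ tower m := Nat.pow_le_pow_right (by norm_num)
        (by have := tower_mono (Nat.zero_le m); simpa [tower] using this)
      simp only [tower] at h1
      rw [pow_add]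
      omega
    cases i with
    | zero =>
      have := Bool.toNat_le ((tosses p k 0).testBit 0)
      simp only [tosses]
      omega
    | succ i =>
      have := toss_lt (tosses_ne hp k i hi) (hb i (by omega)) (hb _ hi)
      simp only [tosses]
      omega

/-- The least color different from `x` and `y`. -/
def mex (x y : ℕ) : ℕ :=
  if x ≠ 0 ∧ y ≠ 0 then 0 else if x ≠ 1 ∧ y ≠ 1 then 1 else 2

theorem mex_spec (x y : ℕ) : mex x y ≤ 2 ∧ mex x y ≠ x ∧ mex x y ≠ y := by
  unfold mex
  split_ifs <;> omega

/-- Recolor the positions of color `m`. -/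
def recolor (n m : ℕ) (c : ℕ → ℕ) (i : ℕ) : ℕ :=
  if c i = m then
    mex (if 0 < i then c (i - 1) else 3) (if i + 1 < n then c (i + 1) else 3)
  else c i

theorem recolor_spec {n m : ℕ} (hm : 3 ≤ m) {c : ℕ → ℕ}
    (hc : (∀ i, i + 1 < n → c i ≠ c (i + 1)) ∧ ∀ i < n, c i ≤ m) :
    (∀ i, i + 1 < n → recolor n m c i ≠ recolor n m c (i + 1)) ∧
      ∀ i < n, recolor n m c i ≤ m - 1 := by
  constructor
  · intro i hi
    have h1 := hc.1 i hi
    unfold recolor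
    have h2 := mex_spec (if 0 < i then c (i - 1) else 3) (if i + 1 < n then c (i + 1) else 3)
    have h3 := mex_spec (if 0 < i + 1 then c (i + 1 - 1) else 3)
      (if i + 1 + 1 < n then c (i + 1 + 1) else 3)
    rw [if_pos hi] at h2 ⊢
    rw [if_pos (Nat.succ_pos i), Nat.add_sub_cancel] at h3 ⊢
    split_ifs at * <;> omega
  · intro i hi
    have h1 := hc.2 i hi
    have h2 := mex_spec (if 0 < i then c (i - 1) else 3) (if i + 1 < n then c (i + 1) else 3)
    unfold recolor
    by_cases h : c i = m
    · rw [if_pos h]; omega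
    · rw [if_neg h]; omega

/-- A coloring with three colors. -/
noncomputable def three (W : ℕ) (p : List ℕ) : ℕ → ℕ :=
  recolor p.length 3 (recolor p.length 4 (recolor p.length 5 (tosses p (logStar W))))

theorem three_spec {W : ℕ} {p : List ℕ} (hp : IsColored W p) :
    (∀ i, i + 1 < p.length → three W p i ≠ three W p (i + 1)) ∧
      ∀ i < p.length, three W p i ≤ 2 := by
  refine recolor_spec le_rfl (recolor_spec (m := 4) (by norm_num)
    (recolor_spec (m := 5) (by norm_num) ⟨tosses_ne hp _, fun i hi => ?_⟩))
  have := tosses_le hp (logStar W) 0 (by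
    have := (logStar_le_iff W _).1 le_rfl
    rw [Nat.zero_add]; omega) i hi
  simpa [tower] using this

/-- The three-coloring with its ends adjusted. -/
noncomputable def ends (W : ℕ) (p : List ℕ) (i : ℕ) : ℕ :=
  if i = 0 then 2 else if i + 1 = p.length then 0
  else if i = 1 then (if three W p (i + 1) = 0 then 1 else 0)
  else if i + 2 = p.length then (if three W p (i - 1) = 2 then 1 else 2)
  else three W p i

theorem ends_spec {W : ℕ} {p : List ℕ} (hp : IsColored W p) (hn : 5 ≤ p.length) :
    (∀ i, i + 1 < p.length → ends W p i ≠ ends W p (i + 1)) ∧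
      ∀ i < p.length, ends W p i ≤ 2 := by
  obtain ⟨h1, h2⟩ := three_spec hp
  constructor
  · intro i hi
    have h3 := h1 i hi
    have h4 := h2 i (by omega)
    have h5 := h2 (i + 1) hi
    unfold ends
    simp only [Nat.add_sub_cancel]
    split_ifs <;> first | omega | (subst_vars; simp_all)
  · intro i hi
    have := h2 i hi
    unfold ends
    split_ifs <;> omega

/-- `i` starts a block. -/
def Start (W : ℕ) (p : List ℕ) (i : ℕ) : Prop :=
  i = 0 ∨ (5 ≤ p.length ∧ i + 1 < p.length ∧ ends W p (i - 1) < ends W p i ∧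
    ends W p (i + 1) < ends W p i)

theorem start_spec {W : ℕ} {p : List ℕ} (hp : IsColored W p) :
    (∀ i, i + 1 < p.length → ¬ (Start W p i ∧ Start W p (i + 1))) ∧
    (∀ i, i + 3 < p.length → Start W p i ∨ Start W p (i + 1) ∨ Start W p (i + 2) ∨
      Start W p (i + 3)) ∧
    (2 ≤ p.length → ¬ Start W p (p.length - 1)) := by
  refine ⟨?_, ?_, ?_⟩
  · rintro i hi ⟨h1, h2⟩
    rcases h2 with h2 | ⟨h5, h6, h7, h8⟩
    · omega
    rw [Nat.add_sub_cancel] at h7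
    rcases h1 with rfl | h1
    · have := (ends_spec hp h5).2 1 (by omega)
      have h0 : ends W p 0 = 2 := by simp [ends]
      simp only [Nat.zero_add] at h7
      omega
    · omega
  · intro i hi
    rcases Nat.eq_zero_or_pos i with h0 | h0
    · exact Or.inl (Or.inl h0)
    have hn : 5 ≤ p.length := by omega
    obtain ⟨h1, h2⟩ := ends_spec hp hn
    obtain ⟨i, rfl⟩ : ∃ j, i = j + 1 := ⟨i - 1, by omega⟩
    have a0 := h1 i (by omega)
    have a1 := h1 (i + 1) (by omega)
    have a2 := h1 (i + 2) (by omega)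
    have a3 := h1 (i + 3) (by omega)
    have b0 := h2 i (by omega)
    have b1 := h2 (i + 1) (by omega)
    have b2 := h2 (i + 2) (by omega)
    have b3 := h2 (i + 3) (by omega)
    have b4 := h2 (i + 4) (by omega)
    have hl : i + 5 = p.length → ends W p (i + 4) = 0 := by
      intro h; simp [ends, h]
    by_contra hc
    simp only [Start, not_or, not_and] at hc
    obtain ⟨⟨-, c1⟩, ⟨-, c2⟩, ⟨-, c3⟩, ⟨-, c4⟩⟩ := hc
    have c1 := c1 hn (by omega)
    have c2 := c2 hn (by omega)
    have c3 := c3 hn (by omega)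
    rw [show i + 1 - 1 = i by omega] at c1
    rw [show i + 1 + 1 - 1 = i + 1 by omega] at c2
    rw [show i + 1 + 2 - 1 = i + 2 by omega] at c3
    rw [show i + 1 + 3 - 1 = i + 3 by omega] at c4
    rcases Nat.lt_or_ge (i + 5) p.length with h | h
    · have a4 := h1 (i + 4) (by omega)
      have b5 := h2 (i + 5) (by omega)
      have c4 := c4 hn (by omega)
      simp only [Nat.add_assoc, Nat.reduceAdd] at *
      omega
    · have := hl (by omega)
      simp only [Nat.add_assoc, Nat.reduceAdd] at *
      omega
  · rintro hn (h | h) <;> omega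

/-- The sequences `p` and `q` agree around the positions `i` and `j`, up to the distance `A` to
the left and `B` to the right. -/
def Agree (A B : ℕ) (p : List ℕ) (i : ℕ) (q : List ℕ) (j : ℕ) : Prop :=
  (∀ d ≤ A, (d ≤ i ↔ d ≤ j) ∧ (d ≤ i → p.getD (i - d) 0 = q.getD (j - d) 0)) ∧
  (∀ d ≤ B, (i + d < p.length ↔ j + d < q.length) ∧
    (i + d < p.length → p.getD (i + d) 0 = q.getD (j + d) 0)) ∧ i < p.length ∧ j < q.length

theorem Agree.mono {A B A' B' : ℕ} {p q : List ℕ} {i j : ℕ} (h : Agree A B p i q j)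
    (hA : A' ≤ A) (hB : B' ≤ B) : Agree A' B' p i q j :=
  ⟨fun d hd => h.1 d (hd.trans hA), fun d hd => h.2.1 d (hd.trans hB), h.2.2⟩

theorem Agree.left {A B : ℕ} {p q : List ℕ} {i j : ℕ} (h : Agree (A + 1) B p (i + 1) q (j + 1)) :
    Agree A (B + 1) p i q j := by
  obtain ⟨h1, h2, h3, h4⟩ := h
  refine ⟨fun d hd => ?_, fun d hd => ?_, by omega, by omega⟩
  · have := h1 (d + 1) (by omega)
    simpa [Nat.add_sub_add_right] using this
  · cases d with
    | zero => 
      have := h1 1 (by omega)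
      simp only [Nat.add_sub_cancel] at this
      simp only [Nat.add_zero]
      exact ⟨by omega, fun _ => this.2 (by omega)⟩
    | succ d =>
      have := h2 d (by omega)
      simpa [Nat.add_assoc, Nat.add_comm 1 d] using this

theorem Agree.right {A B : ℕ} {p q : List ℕ} {i j : ℕ} (h : Agree A (B + 1) p i q j)
    (hi : i + 1 < p.length) : Agree (A + 1) B p (i + 1) q (j + 1) := by
  obtain ⟨h1, h2, h3, h4⟩ := h
  have hj := (h2 1 (by omega)).1.1 hi
  refine ⟨fun d hd => ?_, fun d hd => ?_, hi, hj⟩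
  · cases d with
    | zero =>
      have := h2 1 (by omega)
      exact ⟨by omega, fun _ => this.2 hi⟩
    | succ d =>
      have := h1 d (by omega)
      simpa [Nat.add_sub_add_right] using this
  · have := h2 (d + 1) (by omega)
    simpa [Nat.add_assoc, Nat.add_comm 1 d] using this

theorem tosses_agree (k : ℕ) : ∀ {p q : List ℕ} {i j : ℕ}, Agree k 0 p i q j →
    tosses p k i = tosses q k j := by
  induction k with
  | zero =>
    intro p q i j h
    simpa [tosses] using (h.1 0 le_rfl).2 (Nat.zero_le _)
  | succ k ih =>
    intro p q i j h
    have h0 := (h.1 1 (by omega)).1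
    cases i with
    | zero =>
      obtain rfl : j = 0 := by omega
      simp only [tosses]
      rw [ih (h.mono (by omega) le_rfl)]
    | succ i =>
      obtain ⟨j, rfl⟩ : ∃ j', j = j' + 1 := ⟨j - 1, by omega⟩
      simp only [tosses]
      rw [ih (h.mono (by omega) le_rfl), ih (h.left.mono le_rfl (by omega))]

theorem recolor_agree {A B m : ℕ} {c : List ℕ → ℕ → ℕ}
    (hc : ∀ {p q : List ℕ} {i j : ℕ}, Agree A B p i q j → c p i = c q j)
    {p q : List ℕ} {i j : ℕ} (h : Agree (A + 1) (B + 1) p i q j) :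
    recolor p.length m (c p) i = recolor q.length m (c q) j := by
  have h1 := hc (h.mono (by omega) (by omega))
  have h2 : (if 0 < i then c p (i - 1) else 3) = (if 0 < j then c q (j - 1) else 3) := by
    have h0 := (h.1 1 (by omega)).1
    cases i with
    | zero =>
      obtain rfl : j = 0 := by omega
      rfl
    | succ i =>
      obtain ⟨j, rfl⟩ : ∃ j', j = j' + 1 := ⟨j - 1, by omega⟩
      simpa using hc (h.left.mono le_rfl (by omega))
  have h3 : (if i + 1 < p.length then c p (i + 1) else 3) =
      (if j + 1 < q.length then c q (j + 1) else 3) := by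
    have h0 := (h.2.1 1 (by omega)).1
    by_cases hi : i + 1 < p.length
    · rw [if_pos hi, if_pos (h0.1 hi)]
      exact hc ((h.right hi).mono (by omega) le_rfl)
    · rw [if_neg hi, if_neg (fun hh => hi (h0.2 hh))]
  unfold recolor
  rw [h1, h2, h3]

theorem three_agree {W : ℕ} {p q : List ℕ} {i j : ℕ} (h : Agree (logStar W + 3) 3 p i q j) :
    three W p i = three W q j :=
  recolor_agree (c := fun p => recolor p.length 4 (recolor p.length 5 (tosses p (logStar W))))
    (fun h => recolor_agree (c := fun p => recolor p.length 5 (tosses p (logStar W)))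
      (fun h => recolor_agree (c := fun p => tosses p (logStar W))
        (fun h => tosses_agree _ h) h) h) h

theorem ends_congr {W : ℕ} {p q : List ℕ} {i j : ℕ} (c0 : i = 0 ↔ j = 0)
    (c1 : i + 1 = p.length ↔ j + 1 = q.length) (c2 : i = 1 ↔ j = 1)
    (c3 : i + 2 = p.length ↔ j + 2 = q.length) (t : three W p i = three W q j)
    (tr : i = 1 → three W p (i + 1) = three W q (j + 1))
    (tl : i + 2 = p.length → three W p (i - 1) = three W q (j - 1)) :
    ends W p i = ends W q j := by
  unfold ends
  by_cases h0 : i = 0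
  · rw [if_pos h0, if_pos (c0.1 h0)]
  rw [if_neg h0, if_neg (fun h => h0 (c0.2 h))]
  by_cases h1 : i + 1 = p.length
  · rw [if_pos h1, if_pos (c1.1 h1)]
  rw [if_neg h1, if_neg (fun h => h1 (c1.2 h))]
  by_cases h2 : i = 1
  · rw [if_pos h2, if_pos (c2.1 h2), tr h2]
  rw [if_neg h2, if_neg (fun h => h2 (c2.2 h))]
  by_cases h3 : i + 2 = p.length
  · rw [if_pos h3, if_pos (c3.1 h3), tl h3]
  rw [if_neg h3, if_neg (fun h => h3 (c3.2 h)), t]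

theorem start_agree {W : ℕ} {p q : List ℕ} {i j : ℕ} (h : Agree (logStar W + 6) 4 p i q j)
    (hs : Start W p i) : Start W q j := by
  have l1 := (h.1 1 (by omega)).1
  have l2 := (h.1 2 (by omega)).1
  have l3 := (h.1 3 (by omega)).1
  have l4 := (h.1 4 (by omega)).1
  have r1 := (h.2.1 1 (by omega)).1
  have r2 := (h.2.1 2 (by omega)).1
  have r3 := (h.2.1 3 (by omega)).1
  have r4 := (h.2.1 4 (by omega)).1
  rcases Nat.eq_zero_or_pos i with h0 | h0
  · exact Or.inl (by omega)
  rcases hs with hs | ⟨h5, h6, h7, h8⟩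
  · omega
  obtain ⟨i, rfl⟩ : ∃ i', i = i' + 1 := ⟨i - 1, by omega⟩
  obtain ⟨j, rfl⟩ : ∃ j', j = j' + 1 := ⟨j - 1, by omega⟩
  have t0 := three_agree (h.left.mono (by omega) (by omega) : Agree (logStar W + 3) 3 p i q j)
  have t1 := three_agree (h.mono (by omega) (by omega) :
    Agree (logStar W + 3) 3 p (i + 1) q (j + 1))
  have t2 := three_agree ((h.right h6).mono (by omega) (by omega) :
    Agree (logStar W + 3) 3 p (i + 1 + 1) q (j + 1 + 1))
  clear h
  have e0 : ends W p i = ends W q j :=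
    ends_congr (by omega) (by omega) (by omega) (by omega) t0 (fun _ => t1) (by omega)
  have e1 : ends W p (i + 1) = ends W q (j + 1) :=
    ends_congr (by omega) (by omega) (by omega) (by omega) t1 (fun _ => t2) (fun _ => t0)
  have e2 : ends W p (i + 1 + 1) = ends W q (j + 1 + 1) :=
    ends_congr (by omega) (by omega) (by omega) (by omega) t2 (by omega) (fun _ => t1)
  refine Or.inr ⟨by omega, by omega, ?_, ?_⟩
  · rwa [Nat.add_sub_cancel, ← e0, ← e1]
  · rwa [← e1, ← e2]

/-- The part of `p` that a local rule sees at position `i`. -/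
noncomputable def window (W : ℕ) (p : List ℕ) (i : ℕ) : Fin (logStar W + 11) → Option ℕ :=
  fun k => if logStar W + 6 ≤ i + k then p[i + k - (logStar W + 6)]? else none

theorem agree_of_window {W : ℕ} {p q : List ℕ} {i j : ℕ} (hi : i < p.length) (hj : j < q.length)
    (h : window W p i = window W q j) : Agree (logStar W + 6) 4 p i q j := by
  refine ⟨fun d hd => ?_, fun d hd => ?_, hi, hj⟩
  · have hk := congrFun h ⟨logStar W + 6 - d, by omega⟩
    simp only [window] at hk
    rw [show i + (logStar W + 6 - d) - (logStar W + 6) = i - d by omega,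
      show j + (logStar W + 6 - d) - (logStar W + 6) = j - d by omega,
      List.getElem?_eq_getElem (show i - d < p.length by omega),
      List.getElem?_eq_getElem (show j - d < q.length by omega)] at hk
    rw [List.getD_eq_getElem _ _ (show i - d < p.length by omega),
      List.getD_eq_getElem _ _ (show j - d < q.length by omega)]
    split_ifs at hk with h1 h2 h2
    · exact ⟨by omega, fun _ => Option.some.inj hk⟩
    · exact ⟨by omega, fun _ => by omega⟩
  · have hk := congrFun h ⟨logStar W + 6 + d, by omega⟩
    simp only [window] at hk
    rw [if_pos (by omega), if_pos (by omega),
      show i + (logStar W + 6 + d) - (logStar W + 6) = i + d by omega,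
      show j + (logStar W + 6 + d) - (logStar W + 6) = j + d by omega] at hk
    constructor
    · have h1 : p[i + d]? = none ↔ q[j + d]? = none := by rw [hk]
      rw [List.getElem?_eq_none_iff, List.getElem?_eq_none_iff] at h1
      omega
    · intro _
      rw [List.getD_eq_getElem?_getD, List.getD_eq_getElem?_getD, hk]

/-- For every `W` there is a locally consistent parsing of the `W`-colored sequences. -/
theorem exists_isLocallyConsistent (W : ℕ) : ∃ f, IsLocallyConsistent W f := by
  classical
  refine ⟨fun w => decide (∃ p i, i < p.length ∧ window W p i = w ∧ Start W p i), fun p hp => ?_⟩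
  have key : ∀ i < p.length,
      (bit (fun w => decide (∃ p i, i < p.length ∧ window W p i = w ∧ Start W p i)) p i = true ↔
        Start W p i) := by
    intro i hi
    rw [bit, decide_eq_true_iff]
    constructor
    · rintro ⟨q, j, hj, hw, hs⟩
      exact start_agree (agree_of_window hj hi hw) hs
    · intro hs
      exact ⟨p, i, hi, rfl, hs⟩
  obtain ⟨h1, h2, h3⟩ := start_spec hp
  refine ⟨fun h => (key 0 h).2 (Or.inl rfl), fun i hi => ?_, fun i hi => ?_, fun hn => ?_⟩
  · rw [key i (by omega), key (i + 1) hi]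
    exact h1 i hi
  · rw [key i (by omega), key (i + 1) (by omega), key (i + 2) (by omega), key (i + 3) hi]
    exact h2 i hi
  · rw [← Bool.not_eq_true, key _ (by omega)]
    exact h3 hn

/-! ### Run-length grammars -/

/-- Right-hand sides of productions: a terminal, a pair of variables, a power of a variable. -/
inductive Rhs (α : Type*) where
  | term (a : α) : Rhs α
  | pair (l r : ℕ) : Rhs α
  | run (b k : ℕ) : Rhs α

/-- The variables that occur in a right-hand side. -/
def Rhs.Uses {α : Type*} : Rhs α → ℕ → Prop
  | .term _, _ => False
  | .pair l r, x => x = l ∨ x = r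
  | .run b _, x => x = b

/-- Run-length grammars: finitely many positive integers as variables, exactly one production
for each of them (`prod e` matters only for `e ∈ vars`), whose right-hand side only uses smaller
variables and positive exponents. Different variables have different right-hand sides, so that
the left-hand side of a production is a function of its right-hand side. -/
structure RLGrammar (α : Type*) where
  vars : Finset ℕ
  prod : ℕ → Rhs α
  pos : ∀ e ∈ vars, 0 < e
  uses_mem : ∀ e ∈ vars, ∀ x, (prod e).Uses x → x ∈ vars ∧ x < e
  run_pos : ∀ e ∈ vars, ∀ b k, prod e = .run b k → 0 < k
  inj : ∀ e ∈ vars, ∀ e' ∈ vars, prod e = prod e' → e = e'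

namespace RLGrammar

variable {α : Type*} (G : RLGrammar α)

/-- The string derived by a variable. -/
def val (e : ℕ) : List α :=
  if he : e ∈ G.vars then
    match hr : G.prod e with
    | .term a => [a]
    | .pair l r => val l ++ val r
    | .run b k => (List.replicate k (val b)).flatten
  else []
termination_by e
decreasing_by
  · exact (G.uses_mem e he l (by rw [hr]; exact Or.inl rfl)).2
  · exact (G.uses_mem e he r (by rw [hr]; exact Or.inr rfl)).2
  · exact (G.uses_mem e he b (by rw [hr]; exact rfl)).2

/-- The string derived by a sequence of variables. -/
def valSeq (y : List ℕ) : List α := (y.map G.val).flatten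

/-- `G.Occurs x c e`: the derivation tree of `e` has a node labeled `x` such that exactly `c`
leaves lie to the left of the subtree of this node. -/
inductive Occurs : ℕ → ℕ → ℕ → Prop
  | root (e : ℕ) (he : e ∈ G.vars) : Occurs e 0 e
  | left (e l r x c : ℕ) (he : e ∈ G.vars) (hr : G.prod e = .pair l r) (h : Occurs x c l) :
      Occurs x c e
  | right (e l r x c : ℕ) (he : e ∈ G.vars) (hr : G.prod e = .pair l r) (h : Occurs x c r) :
      Occurs x ((G.val l).length + c) e
  | run (e b k j x c : ℕ) (he : e ∈ G.vars) (hr : G.prod e = .run b k) (hj : j < k)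
      (h : Occurs x c b) : Occurs x (j * (G.val b).length + c) e

/-- The sequence `y` occurs at position `c` in `e`. -/
def OccursSeq (y : List ℕ) (c e : ℕ) : Prop :=
  ∀ (j : ℕ) (hj : j < y.length), G.Occurs y[j] (c + (G.valSeq (y.take j)).length) e

/-- `e` is the signature of the right-hand side `x`. -/
def IsSig (x : Rhs α) (e : ℕ) : Prop := e ∈ G.vars ∧ G.prod e = x

/-- `e` is the signature of a block of two, three or four variables, which are combined
from left to right. -/
def IsSigBlock : List ℕ → ℕ → Prop
  | [a, b], e => G.IsSig (.pair a b) e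
  | [a, b, c], e => ∃ e₁, G.IsSig (.pair a b) e₁ ∧ G.IsSig (.pair e₁ c) e
  | [a, b, c, d], e => ∃ e₁ e₂, G.IsSig (.pair a b) e₁ ∧ G.IsSig (.pair e₁ c) e₂ ∧
      G.IsSig (.pair e₂ d) e
  | _, _ => False

/-- `S` is the signature `id(T)` of the string `T`: it is the only entry of `Pow_h(T)` for the
least `h` such that `Pow_h(T)` has length one. -/
def IsId {W : ℕ} (f : (Fin (logStar W + 11) → Option ℕ) → Bool) (T : List α) (S : ℕ) : Prop :=
  ∃ (h : ℕ) (shrink pow : ℕ → List ℕ),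
    List.Forall₂ (fun a e => G.IsSig (.term a) e) T (shrink 0) ∧
    (∀ t ≤ h, List.Forall₂ (fun r e => G.IsSig (.run r.1 r.2) e) (encpow (shrink t)) (pow t)) ∧
    (∀ t < h, List.Forall₂ G.IsSigBlock (eblock f (pow t)) (shrink (t + 1))) ∧
    (∀ t < h, (pow t).length ≠ 1) ∧ pow h = [S]

/-- `G` is the signature encoding, with respect to the parsing rule `f` for `W`-colored sequences,
of the texts in `𝒯`: all signatures are at most `W`, every text has a signature, and every
variable other than these is used by a production. For `𝒯 = {T}` this is the signature encoding
of the text `T`, with start symbol `id(T)`. -/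
def IsSignatureEncoding {W : ℕ} (f : (Fin (logStar W + 11) → Option ℕ) → Bool)
    (𝒯 : Set (List α)) : Prop :=
  (∀ e ∈ G.vars, e ≤ W) ∧ (∀ T ∈ 𝒯, ∃ S, G.IsId f T S) ∧
    ∀ e ∈ G.vars, (∃ T ∈ 𝒯, G.IsId f T e) ∨ ∃ e' ∈ G.vars, (G.prod e').Uses e

end RLGrammar

end SigEnc

/-! Each level of the parse of a text is determined by the level below it, and productions are
injective, so equal pieces get equal signatures. Let `X` be a factor of `Shrink_t`. A context of `X`
can only extend its first run `L` and its last run `R`; the runs in between have the same signatures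
`Y` in every context, and these are contiguous in `Pow_t` (`IsPow.inner`). A bit sees `ΔL` entries
to the left and `4` to the right, so away from its ends `Y` has the same bits in every context as in
isolation (`bit_append`). As `Y` is itself colored, it has cuts close to both ends
(`exists_boundaries`), and the blocks between them are the same in every context (`exists_blocks`).
Their signatures form a factor `X'` of `Shrink_{t+1}` with at most half as many entries as `X`.

The common sequence of `X` is therefore `L`, a short prefix of `Y`, the common sequence of `X'`, a
short suffix of `Y`, and `R`; when `X` has few runs, it is `X` itself
(`RLGrammar.exists_common_seq`). Every level adds `O(log* W)` runs and the lengths halve, which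
gives `O(log* W · log |P|)` runs, and `W ≤ K M` replaces `log* W` by `O(log* M)`.

This treats occurrences in the start symbols. An arbitrary variable `e` occurs in the tree of some
`id(T)` (`IsSignatureEncoding.exists_occurs`), so an occurrence of `P` in `val(e)` yields one in
`T`, where the common sequence occurs in `id(T)`. Its nodes lie below the node `e` unless one of
them is an ancestor with the same leaves, as productions `ê^1` allow. This is excluded since either
the sequence has two entries, each deriving less than `P`, or its entries are signatures of
characters (`OccursSeq.nested`). -/

namespace SigEnc

/-! ### Runs -/

/-- The number of maximal runs of equal entries. -/
def runs : List ℕ → ℕ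
  | [] => 0
  | [_] => 1
  | x :: y :: l => runs (y :: l) + if x = y then 0 else 1

theorem splitBy_cons_self (y : ℕ) (l : List ℕ) {g : List ℕ} {gs : List (List ℕ)}
    (h : (y :: l).splitBy (fun a b => a == b) = g :: gs) :
    (y :: y :: l).splitBy (fun a b => a == b) = (y :: g) :: gs := by
  rw [List.splitBy_eq_iff] at h ⊢
  obtain ⟨h1, h2, h3, h4⟩ := h
  have hg : g ≠ [] := by rintro rfl; simp at h2
  obtain ⟨z, g, rfl⟩ := List.exists_cons_of_ne_nil hg
  simp only [List.flatten_cons, List.cons_append, List.cons.injEq] at h1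
  obtain ⟨rfl, h1⟩ := h1
  refine ⟨by simp [h1], by simpa using h2, ?_, ?_⟩
  · intro m hm
    rcases List.mem_cons.1 hm with rfl | hm
    · have := h3 (y :: g) (by simp)
      simp only [List.isChain_cons_cons]
      exact ⟨by simp, this⟩
    · exact h3 m (by simp [hm])
  · rw [List.isChain_cons] at h4 ⊢
    refine ⟨fun q hq => ?_, h4.2⟩
    obtain ⟨_, hb, h5⟩ := h4.1 q hq
    exact ⟨by simp, hb, by simpa using h5⟩

/-- The recursive count `runs` makes subadditivity an easy induction; this lemma ties it to the run
decomposition. -/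
theorem length_encpow (s : List ℕ) : (encpow s).length = runs s := by
  rw [encpow, List.length_map]
  induction s with
  | nil => simp [runs]
  | cons x s ih =>
    cases s with
    | nil => rw [List.splitBy_of_isChain (by simp) (by simp)]; simp [runs]
    | cons y l =>
      rw [runs, ← ih]
      split_ifs with h
      · subst h
        obtain ⟨g, gs, hg⟩ := List.exists_cons_of_ne_nil
          (List.splitBy_ne_nil (r := fun a b : ℕ => a == b).2 (List.cons_ne_nil x l))
        rw [splitBy_cons_self x l hg, hg]
        simp
      · have := List.splitBy_append (r := fun a b : ℕ => a == b) (l := [x]) (m := y :: l)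
          (by simpa using h)
        rw [List.singleton_append] at this
        rw [this, List.splitBy_of_isChain (l := [x]) (by simp) (by simp)]
        simp

theorem runs_cons_le (x : ℕ) (l : List ℕ) : runs (x :: l) ≤ 1 + runs l := by
  cases l with
  | nil => simp [runs]
  | cons y l => rw [runs]; split_ifs <;> omega

theorem runs_le_length (s : List ℕ) : runs s ≤ s.length := by
  induction s with
  | nil => simp [runs]
  | cons x s ih => have := runs_cons_le x s; simp only [List.length_cons]; omega

theorem runs_append_le (u w : List ℕ) : runs (u ++ w) ≤ runs u + runs w := by
  induction u with
  | nil => simp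
  | cons x u ih =>
    cases u with
    | nil => simpa [runs] using runs_cons_le x w
    | cons y u =>
      simp only [List.cons_append, runs] at ih ⊢
      omega

theorem runs_replicate_le (n a : ℕ) : runs (List.replicate n a) ≤ 1 := by
  induction n with
  | zero => simp [runs]
  | succ n ih =>
    cases n with
    | zero => simp [runs]
    | succ n => simpa [List.replicate_succ, runs] using ih

/-- The last entry of `u` differs from the first entry of `w`. -/
def Junction (u w : List ℕ) : Prop := ∀ x ∈ u.getLast?, ∀ y ∈ w.head?, x ≠ y

theorem Junction.append_left {u w : List ℕ} (h : Junction u w) (hu : u ≠ []) (a : List ℕ) :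
    Junction (a ++ u) w := by
  intro x hx
  rw [List.getLast?_append_of_ne_nil _ hu] at hx
  exact h x hx

theorem Junction.append_right {u w : List ℕ} (h : Junction u w) (hw : w ≠ []) (b : List ℕ) :
    Junction u (w ++ b) := by
  intro x hx y hy
  rw [List.head?_append_of_ne_nil _ hw] at hy
  exact h x hx y hy

theorem encpow_append {u w : List ℕ} (h : Junction u w) : encpow (u ++ w) = encpow u ++ encpow w := by
  rw [encpow, List.splitBy_append (fun x hx y hy => by simpa using h x hx y hy), List.map_append]
  rfl

theorem exists_first_run {s : List ℕ} (hs : s ≠ []) :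
    ∃ n a w, s = List.replicate (n + 1) a ++ w ∧ Junction (List.replicate (n + 1) a) w := by
  induction s with
  | nil => exact absurd rfl hs
  | cons x s ih =>
    cases s with
    | nil => exact ⟨0, x, [], by simp, by simp [Junction]⟩
    | cons y s =>
      obtain ⟨n, a, w, h1, h2⟩ := ih (by simp)
      by_cases h : x = a
      · subst h
        refine ⟨n + 1, x, w, by rw [h1]; simp [List.replicate_succ], ?_⟩
        have := h2.append_left (by simp) [x]
        simpa [List.replicate_succ] using this
      · refine ⟨0, x, y :: s, by simp, ?_⟩
        rw [h1]
        simpa [Junction, List.replicate_succ] using h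

theorem exists_last_run {s : List ℕ} (hs : s ≠ []) :
    ∃ u n a, s = u ++ List.replicate (n + 1) a ∧ Junction u (List.replicate (n + 1) a) := by
  induction s with
  | nil => exact absurd rfl hs
  | cons x s ih =>
    cases s with
    | nil => exact ⟨[], 0, x, by simp, by simp [Junction]⟩
    | cons y s =>
      obtain ⟨u, n, a, h1, h2⟩ := ih (by simp)
      by_cases hu : u = []
      · subst hu
        by_cases h : x = a
        · exact ⟨[], n + 1, a, by rw [h1, h]; simp [List.replicate_succ], by simp [Junction]⟩
        · refine ⟨[x], n, a, by rw [h1]; simp, ?_⟩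
          simpa [Junction, List.replicate_succ] using h
      · exact ⟨x :: u, n, a, by rw [h1]; simp, h2.append_left hu [x]⟩

/-- Separates the two runs that a context may prolong from the inner part `M`, whose runs stay
maximal in every context. -/
theorem exists_outer_runs {s : List ℕ} (hs : s ≠ []) :
    (∃ n a, s = List.replicate n a) ∨ ∃ n a m b M,
      s = List.replicate (n + 1) a ++ M ++ List.replicate (m + 1) b ∧
      Junction (List.replicate (n + 1) a) (M ++ List.replicate (m + 1) b) ∧
      Junction M (List.replicate (m + 1) b) := by
  obtain ⟨n, a, w, h1, h2⟩ := exists_first_run hs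
  by_cases hw : w = []
  · exact Or.inl ⟨n + 1, a, by rw [h1, hw]; simp⟩
  · obtain ⟨M, m, b, h3, h4⟩ := exists_last_run hw
    subst h3
    exact Or.inr ⟨n, a, m, b, M, by rw [h1]; simp, h2, h4⟩

theorem eq_replicate_of_isChain {q : List ℕ} (h : q.IsChain (fun a b => (a == b) = true)) :
    q = List.replicate q.length (q.headD 0) := by
  induction q with
  | nil => rfl
  | cons x q ih =>
    cases q with
    | nil => rfl
    | cons y q =>
      rw [List.isChain_cons_cons] at h
      have h1 := ih h.2
      have hxy : x = y := by simpa using h.1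
      subst hxy
      simp only [List.headD_cons, List.length_cons] at h1 ⊢
      rw [List.replicate_succ, ← h1]

/-- Maximality of the runs; it makes the signatures of the runs a colored sequence. -/
theorem encpow_isChain (s : List ℕ) : (encpow s).IsChain (fun q r => q.1 ≠ r.1) := by
  rw [encpow, List.isChain_map, List.isChain_iff_getElem]
  intro i hi
  obtain ⟨h1, h2, h3⟩ := List.isChain_iff_getElem.1
    (List.isChain_getLast_head_splitBy (fun a b : ℕ => a == b) s) i hi
  have hq := List.getElem_mem (Nat.lt_of_succ_lt hi)
  generalize (s.splitBy (fun a b => a == b))[i] = q at *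
  generalize (s.splitBy (fun a b => a == b))[i + 1] = r at *
  have h4 := eq_replicate_of_isChain (List.isChain_of_mem_splitBy hq)
  have h5 : q.getLast h1 = q.headD 0 := by
    have := List.getLast_mem h1
    generalize q.getLast h1 = z at this
    rw [h4] at this
    exact (List.mem_replicate.1 this).2
  rw [h5] at h3
  obtain ⟨z, r, rfl⟩ := List.exists_cons_of_ne_nil h2
  simpa using h3

/-! ### Blocks -/

section
variable {W : ℕ} (f : (Fin (logStar W + 11) → Option ℕ) → Bool)

/-- The whole window of the position lies inside `Y`, so neither `A`, `B` nor the symbols `-1` are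
seen. -/
theorem bit_append {A Y B : List ℕ} {i : ℕ} (h1 : logStar W + 6 ≤ i) (h2 : i + 4 < Y.length) :
    bit f (A ++ Y ++ B) (A.length + i) = bit f Y i := by
  unfold bit
  congr 1
  funext k
  have hk := k.2
  rw [if_pos (by omega), if_pos (by omega), List.append_assoc,
    List.getElem?_append_right (by omega), List.getElem?_append_left (by omega)]
  congr 1
  omega

/-- The entries of `p` together with their bits. -/
noncomputable def withBits (p : List ℕ) : List (ℕ × Bool) :=
  p.zip ((List.range p.length).map (bit f p))

/-- Cut a marked sequence in front of the marked positions. -/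
def cut (z : List (ℕ × Bool)) : List (List ℕ) :=
  (z.splitBy (fun _ y => !y.2)).map (fun q => q.map Prod.fst)

theorem flatten_cut (z : List (ℕ × Bool)) : (cut z).flatten = z.map Prod.fst := by
  rw [cut, ← List.map_flatten, List.flatten_splitBy]

theorem cut_append {u w : List (ℕ × Bool)} (h : ∀ y ∈ w.head?, y.2 = true) :
    cut (u ++ w) = cut u ++ cut w := by
  rw [cut, List.splitBy_append (fun x _ y hy => by simp [h y hy]), List.map_append]
  rfl

/-- No block crosses a marked position, so the parts before, between and after two of them can be
cut separately. -/
theorem cut_take_drop (z : List (ℕ × Bool)) (n m : ℕ) (hn : ∀ y ∈ (z.drop n).head?, y.2 = true)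
    (hm : ∀ y ∈ (z.drop (n + m)).head?, y.2 = true) :
    cut z = cut (z.take n) ++ cut ((z.drop n).take m) ++ cut (z.drop (n + m)) := by
  rw [List.append_assoc, ← cut_append hm, ← List.drop_drop, List.take_append_drop,
    ← cut_append hn, List.take_append_drop]

theorem length_withBits (p : List ℕ) : (withBits f p).length = p.length := by
  simp [withBits]

theorem getElem_withBits (p : List ℕ) (i : ℕ) (hi : i < (withBits f p).length) :
    (withBits f p)[i] = (p[i]'(by rwa [length_withBits] at hi), bit f p i) := by
  simp [withBits]

theorem map_fst_withBits (p : List ℕ) : (withBits f p).map Prod.fst = p := by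
  rw [withBits, List.map_fst_zip]
  simp

/-- Between two block boundaries which are determined by `Y`, the blocks are determined by `Y`. -/
theorem exists_blocks {Y : List ℕ} {i m : ℕ} (h1 : logStar W + 6 ≤ i)
    (h2 : i + m + 4 < Y.length) (hi : bit f Y i = true) (hm : bit f Y (i + m) = true) :
    ∃ Q : List (List ℕ), Q.flatten = (Y.drop i).take m ∧
      ∀ A B, ∃ QA QB, eblock f (A ++ Y ++ B) = QA ++ Q ++ QB ∧
        QA.flatten = A ++ Y.take i ∧ QB.flatten = Y.drop (i + m) ++ B := by
  refine ⟨cut (((withBits f Y).drop i).take m), ?_, fun A B => ?_⟩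
  · rw [flatten_cut, List.map_take, List.map_drop, map_fst_withBits]
  -- The marked entries between the two boundaries do not depend on `A` and `B`.
  have hmid : ((withBits f (A ++ Y ++ B)).drop (A.length + i)).take m =
      ((withBits f Y).drop i).take m := by
    apply List.ext_getElem
    · simp only [List.length_take, List.length_drop, length_withBits, List.length_append]
      omega
    · intro j hj hj'
      have : j < m := by
        simp only [List.length_take] at hj
        omega
      rw [List.getElem_take, List.getElem_take, List.getElem_drop, List.getElem_drop,
        getElem_withBits, getElem_withBits]
      simp only [Nat.add_assoc A.length]
      rw [bit_append f (by omega) (by omega)]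
      congr 1
      rw [List.getElem_append_left (by simp only [List.length_append]; omega),
        List.getElem_append_right (by omega)]
      congr 1
      omega
  have hhead : ∀ j, logStar W + 6 ≤ j → j + 4 < Y.length → bit f Y j = true →
      ∀ y ∈ ((withBits f (A ++ Y ++ B)).drop (A.length + j)).head?, y.2 = true := by
    intro j hj1 hj2 hb y hy
    have hl : A.length + j < (withBits f (A ++ Y ++ B)).length := by
      simp only [length_withBits, List.length_append]
      omega
    rw [List.head?_drop, List.getElem?_eq_getElem hl, getElem_withBits] at hy
    rw [← Option.some.inj hy]
    rw [← hb, ← bit_append f hj1 hj2]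
  refine ⟨cut ((withBits f (A ++ Y ++ B)).take (A.length + i)),
    cut ((withBits f (A ++ Y ++ B)).drop (A.length + (i + m))), ?_, ?_, ?_⟩
  · change cut (withBits f (A ++ Y ++ B)) = _
    rw [← hmid, ← Nat.add_assoc]
    refine cut_take_drop _ _ _ (hhead i h1 (by omega) hi) ?_
    rw [Nat.add_assoc]
    exact hhead _ (by omega) (by omega) hm
  · rw [flatten_cut, List.map_take, map_fst_withBits, List.append_assoc, List.take_length_add_append,
      List.take_append_of_le_length (by omega)]
  · rw [flatten_cut, List.map_drop, map_fst_withBits, List.append_assoc, List.drop_length_add_append,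
      List.drop_append_of_le_length (by omega)]

end

theorem IsColored.infix {W : ℕ} {p Y : List ℕ} (hp : IsColored W p) (h : Y <:+: p) :
    IsColored W Y :=
  ⟨hp.1.infix h, fun a ha => hp.2 a (h.subset ha)⟩

/-- A long colored sequence has block boundaries near its ends which are determined by it. -/
theorem exists_boundaries {W : ℕ} {f : (Fin (logStar W + 11) → Option ℕ) → Bool}
    (hf : IsLocallyConsistent W f) {Y : List ℕ} (hY : IsColored W Y)
    (hl : logStar W + 18 ≤ Y.length) :
    ∃ i m, logStar W + 6 ≤ i ∧ i ≤ logStar W + 9 ∧ 0 < m ∧ i + m + 4 < Y.length ∧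
      Y.length ≤ i + m + 8 ∧ bit f Y i = true ∧ bit f Y (i + m) = true := by
  -- Local consistency is applied to `Y` as a sequence of its own: among four consecutive positions
  -- one starts a block. The first four have just enough room on the left; the last four end at `|Y|
  -- - 5`, with `4` entries to the right.
  obtain ⟨-, -, h, -⟩ := hf Y hY
  have h1 : ∃ i, logStar W + 6 ≤ i ∧ i ≤ logStar W + 9 ∧ bit f Y i = true := by
    rcases h (logStar W + 6) (by omega) with h | h | h | h <;>
      exact ⟨_, by omega, by omega, h⟩
  have h2 : ∃ j, j + 4 < Y.length ∧ Y.length ≤ j + 8 ∧ bit f Y j = true := by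
    rcases h (Y.length - 8) (by omega) with h | h | h | h <;>
      exact ⟨_, by omega, by omega, h⟩
  obtain ⟨i, hi1, hi2, hi⟩ := h1
  obtain ⟨j, hj1, hj2, hj⟩ := h2
  refine ⟨i, j - i, hi1, hi2, by omega, by omega, by omega, hi, ?_⟩
  rwa [Nat.add_sub_cancel' (by omega)]

/-! ### Iterated logarithms of products -/

theorem two_mul_le_two_pow {x : ℕ} (hx : 1 ≤ x) : 2 * x ≤ 2 ^ x := by
  induction x, hx using Nat.le_induction with
  | base => norm_num
  | succ n hn ih => rw [pow_succ]; omega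

/-- Squaring doubles the exponent, and one further exponentiation exceeds doubling. Thus a factor
`K` costs `log*` only an additive constant. -/
theorem tower_mul_tower_le (k : ℕ) : tower k * tower k ≤ tower (k + 1) := by
  cases k with
  | zero => simp [tower]
  | succ k =>
    have h1 : 1 ≤ tower k := tower_mono (Nat.zero_le k)
    change 2 ^ tower k * 2 ^ tower k ≤ 2 ^ (2 ^ tower k)
    rw [← pow_add]
    refine Nat.pow_le_pow_right (by norm_num) ?_
    have := two_mul_le_two_pow h1
    omega

theorem logStar_mul_le {K M W : ℕ} (h : W ≤ K * M) :
    logStar W ≤ max (logStar K) (logStar M) + 1 := by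
  rw [logStar_le_iff]
  have h1 : K ≤ tower (max (logStar K) (logStar M)) :=
    (logStar_le_iff _ _).1 (le_max_left _ _)
  have h2 : M ≤ tower (max (logStar K) (logStar M)) :=
    (logStar_le_iff _ _).1 (le_max_right _ _)
  exact h.trans ((Nat.mul_le_mul h1 h2).trans (tower_mul_tower_le _))

theorem one_le_logStar {M : ℕ} (h : 2 ≤ M) : 1 ≤ logStar M := by
  by_contra hc
  have := (logStar_le_iff M 0).1 (by omega)
  simp only [tower] at this
  omega

end SigEnc

namespace SigEnc

namespace RLGrammar

variable {α : Type u} (G : RLGrammar α)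

/-! ### Derived strings and occurrences -/

section
variable {G}

theorem val_term {e : ℕ} {a : α} (h : G.IsSig (.term a) e) : G.val e = [a] := by
  rw [val, dif_pos h.1]
  split <;> simp_all [h.2]

theorem val_pair {e l r : ℕ} (h : G.IsSig (.pair l r) e) : G.val e = G.val l ++ G.val r := by
  rw [val, dif_pos h.1]
  split <;> simp_all [h.2]

theorem val_run {e b k : ℕ} (h : G.IsSig (.run b k) e) :
    G.val e = (List.replicate k (G.val b)).flatten := by
  rw [val, dif_pos h.1]
  split <;> simp_all [h.2]

theorem IsSig.unique {x : Rhs α} {e e' : ℕ} (h : G.IsSig x e) (h' : G.IsSig x e') : e = e' :=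
  G.inj e h.1 e' h'.1 (h.2.trans h'.2.symm)

theorem IsSig.uses {x : Rhs α} {e y : ℕ} (h : G.IsSig x e) (hy : x.Uses y) :
    y ∈ G.vars ∧ y < e :=
  G.uses_mem e h.1 y (by rw [h.2]; exact hy)

theorem val_ne_nil {e : ℕ} (he : e ∈ G.vars) : G.val e ≠ [] := by
  induction e using Nat.strong_induction_on with
  | _ e ih =>
    rcases hr : G.prod e with a | ⟨l, r⟩ | ⟨b, k⟩
    · rw [val_term ⟨he, hr⟩]; simp
    · have hl := IsSig.uses ⟨he, hr⟩ (Or.inl rfl : Rhs.Uses (.pair l r) l)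
      rw [val_pair ⟨he, hr⟩]
      simp [ih l hl.2 hl.1]
    · have hb := IsSig.uses ⟨he, hr⟩ (rfl : Rhs.Uses (.run b k) b)
      have hk := G.run_pos e he b k hr
      rw [val_run ⟨he, hr⟩]
      obtain ⟨k, rfl⟩ : ∃ j, k = j + 1 := ⟨k - 1, by omega⟩
      simp [List.replicate_succ, ih b hb.2 hb.1]

theorem val_length_pos {e : ℕ} (he : e ∈ G.vars) : 0 < (G.val e).length :=
  List.length_pos_of_ne_nil (val_ne_nil he)

theorem length_flatten_replicate (k : ℕ) (s : List α) :
    (List.replicate k s).flatten.length = k * s.length := by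
  simp

theorem Occurs.mem {x c e : ℕ} (h : G.Occurs x c e) : x ∈ G.vars ∧ e ∈ G.vars ∧ x ≤ e := by
  induction h with
  | root e he => exact ⟨he, he, le_rfl⟩
  | left e l r x c he hr h ih =>
    have := IsSig.uses ⟨he, hr⟩ (Or.inl rfl : Rhs.Uses (.pair l r) l)
    exact ⟨ih.1, he, ih.2.2.trans this.2.le⟩
  | right e l r x c he hr h ih =>
    have := IsSig.uses ⟨he, hr⟩ (Or.inr rfl : Rhs.Uses (.pair l r) r)
    exact ⟨ih.1, he, ih.2.2.trans this.2.le⟩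
  | run e b k j x c he hr hj h ih =>
    have := IsSig.uses ⟨he, hr⟩ (rfl : Rhs.Uses (.run b k) b)
    exact ⟨ih.1, he, ih.2.2.trans this.2.le⟩

theorem Occurs.trans {x c e d S : ℕ} (h : G.Occurs x c e) (h' : G.Occurs e d S) :
    G.Occurs x (d + c) S := by
  induction h' with
  | root e he => rwa [Nat.zero_add]
  | left e l r y d he hr h2 ih => exact .left _ _ _ _ _ he hr (ih h)
  | right e l r y d he hr h2 ih => rw [Nat.add_assoc]; exact .right _ _ _ _ _ he hr (ih h)
  | run e b k j y d he hr hj h2 ih => rw [Nat.add_assoc]; exact .run _ _ _ _ _ _ he hr hj (ih h)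

theorem Occurs.val_eq {x c e : ℕ} (h : G.Occurs x c e) :
    ∃ u w, G.val e = u ++ G.val x ++ w ∧ u.length = c := by
  induction h with
  | root e he => exact ⟨[], [], by simp, rfl⟩
  | left e l r x c he hr h ih =>
    obtain ⟨u, w, h1, h2⟩ := ih
    exact ⟨u, w ++ G.val r, by rw [val_pair ⟨he, hr⟩, h1]; simp, h2⟩
  | right e l r x c he hr h ih =>
    obtain ⟨u, w, h1, h2⟩ := ih
    exact ⟨G.val l ++ u, w, by rw [val_pair ⟨he, hr⟩, h1]; simp, by simp [h2]⟩
  | run e b k j x c he hr hj h ih =>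
    obtain ⟨u, w, h1, h2⟩ := ih
    refine ⟨(List.replicate j (G.val b)).flatten ++ u,
      w ++ (List.replicate (k - j - 1) (G.val b)).flatten, ?_, by simp [h2]⟩
    obtain ⟨m, rfl⟩ : ∃ m, k = j + (1 + m) := ⟨k - j - 1, by omega⟩
    rw [val_run ⟨he, hr⟩, List.replicate_add, List.replicate_add, List.flatten_append,
      List.flatten_append, show j + (1 + m) - j - 1 = m by omega]
    simp only [List.replicate_one, List.flatten_singleton]
    rw [h1]
    simp

theorem Occurs.length_le {x c e : ℕ} (h : G.Occurs x c e) :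
    c + (G.val x).length ≤ (G.val e).length := by
  obtain ⟨u, w, h1, h2⟩ := h.val_eq
  rw [h1]
  simp only [List.length_append]
  omega

/-- A node whose leaves are among those of another node is a descendant of it, unless it might be
an ancestor with the same leaves. -/
theorem Occurs.nested {e c S : ℕ} (h : G.Occurs e c S) :
    ∀ {x d : ℕ}, G.Occurs x d S → c ≤ d → d + (G.val x).length ≤ c + (G.val e).length →
      ((G.val x).length < (G.val e).length ∨ ∃ a, G.prod x = .term a) →
      G.Occurs x (d - c) e := by
  induction h with
  | root S hS => intro x d hx _ _ _; exact hx
  | left S l r e c hS hr h ih =>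
    intro x d hx hcd hle hlt
    have hpos := val_length_pos hx.mem.1
    have hl := h.length_le
    cases hx with
    | root => 
      -- Here `x` is `S`, a proper ancestor of `e`: its string is not shorter than that of `e`, and
      -- its production is not terminal.
      rcases hlt with hlt | ⟨a, ha⟩
      · rw [val_pair ⟨hS, hr⟩, List.length_append] at hlt; omega
      · rw [hr] at ha; cases ha
    | left _ l' r' _ _ _ hr' h' =>
      rw [hr] at hr'; cases hr'
      exact ih h' hcd hle hlt
    | right _ l' r' _ d' _ hr' h' =>
      rw [hr] at hr'; cases hr'
      omega
    | run _ b k j _ _ _ hr' => rw [hr] at hr'; cases hr'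
  | right S l r e c hS hr h ih =>
    intro x d hx hcd hle hlt
    have hpos := val_length_pos hx.mem.1
    have hl := h.length_le
    cases hx with
    | root => 
      rcases hlt with hlt | ⟨a, ha⟩
      · rw [val_pair ⟨hS, hr⟩, List.length_append] at hlt; omega
      · rw [hr] at ha; cases ha
    | left _ l' r' _ _ _ hr' h' =>
      rw [hr] at hr'; cases hr'
      have := h'.length_le
      omega
    | right _ l' r' _ d' _ hr' h' =>
      rw [hr] at hr'; cases hr'
      rw [Nat.add_sub_add_left]
      exact ih h' (by omega) (by omega) hlt
    | run _ b k j _ _ _ hr' => rw [hr] at hr'; cases hr'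
  | run S b k j e c hS hr hj h ih =>
    intro x d hx hcd hle hlt
    have hpos := val_length_pos hx.mem.1
    have hl := h.length_le
    cases hx with
    | root => 
      rcases hlt with hlt | ⟨a, ha⟩
      · rw [val_run ⟨hS, hr⟩, length_flatten_replicate] at hlt
        have := Nat.le_mul_of_pos_left (G.val b).length (show 0 < k by omega)
        omega
      · rw [hr] at ha; cases ha
    | left _ l' r' _ _ _ hr' h' => rw [hr] at hr'; cases hr'
    | right _ l' r' _ d' _ hr' h' => rw [hr] at hr'; cases hr'
    | run _ b' k' j' _ d' _ hr' hj' h' =>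
      rw [hr] at hr'; cases hr'
      have hl' := h'.length_le
      -- The copies of `b` have disjoint sets of leaves and `x` has a leaf below `e`, so both nodes
      -- lie in the same copy.
      obtain rfl : j = j' := by
        rcases Nat.lt_trichotomy j j' with h0 | h0 | h0
        · have := Nat.mul_le_mul_right (G.val b).length (show j + 1 ≤ j' from h0)
          rw [Nat.add_mul] at this
          omega
        · exact h0
        · have := Nat.mul_le_mul_right (G.val b).length (show j' + 1 ≤ j from h0)
          rw [Nat.add_mul] at this
          omega
      rw [Nat.add_sub_add_left]
      exact ih h' (by omega) (by omega) hlt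

@[simp] theorem valSeq_nil : G.valSeq [] = [] := rfl

@[simp] theorem valSeq_cons (x : ℕ) (v : List ℕ) : G.valSeq (x :: v) = G.val x ++ G.valSeq v := rfl

@[simp] theorem valSeq_append (u v : List ℕ) : G.valSeq (u ++ v) = G.valSeq u ++ G.valSeq v := by
  simp [valSeq]

theorem length_le_valSeq {v : List ℕ} (h : ∀ x ∈ v, x ∈ G.vars) :
    v.length ≤ (G.valSeq v).length := by
  induction v with
  | nil => simp
  | cons x v ih =>
    have h1 := val_length_pos (h x (by simp))
    have h2 := ih (fun y hy => h y (by simp [hy]))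
    simp only [valSeq_cons, List.length_cons, List.length_append]
    omega

theorem occursSeq_nil (c e : ℕ) : G.OccursSeq [] c e := fun j hj => absurd hj (by simp)

theorem occursSeq_cons {x : ℕ} {v : List ℕ} {c e : ℕ} :
    G.OccursSeq (x :: v) c e ↔ G.Occurs x c e ∧ G.OccursSeq v (c + (G.val x).length) e := by
  constructor
  · intro h
    have h0 := h 0 (by simp)
    rw [List.getElem_cons_zero] at h0
    refine ⟨by simpa using h0, fun j hj => ?_⟩
    have := h (j + 1) (by simpa using hj)
    simpa [Nat.add_assoc] using this
  · rintro ⟨h1, h2⟩ j hj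
    cases j with
    | zero => simpa using h1
    | succ j =>
      have := h2 j (by simpa using hj)
      simpa [Nat.add_assoc] using this

theorem occursSeq_append {u v : List ℕ} {c e : ℕ} :
    G.OccursSeq (u ++ v) c e ↔
      G.OccursSeq u c e ∧ G.OccursSeq v (c + (G.valSeq u).length) e := by
  induction u generalizing c with
  | nil => simp [occursSeq_nil]
  | cons x u ih =>
    rw [List.cons_append, occursSeq_cons, occursSeq_cons, ih, and_assoc, valSeq_cons,
      List.length_append, Nat.add_assoc]

theorem OccursSeq.infix {a X b : List ℕ} {S : ℕ} (h : G.OccursSeq (a ++ X ++ b) 0 S) :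
    G.OccursSeq X (G.valSeq a).length S := by
  have := (occursSeq_append.1 (occursSeq_append.1 h).1).2
  rwa [Nat.zero_add] at this

theorem OccursSeq.replicate {e b k c S : ℕ} (he : G.IsSig (.run b k) e) (h : G.Occurs e c S) :
    G.OccursSeq (List.replicate k b) c S := by
  intro j hj
  have hj : j < k := by simpa using hj
  have hb := he.uses (rfl : Rhs.Uses (.run b k) b)
  have h1 := (Occurs.run e b k j b 0 he.1 he.2 hj (.root b hb.1)).trans h
  rw [List.getElem_replicate]
  convert h1 using 2
  rw [List.take_replicate, Nat.min_eq_left hj.le, valSeq, List.map_replicate,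
    length_flatten_replicate, Nat.add_zero]

theorem Occurs.pair {e l r c S : ℕ} (he : G.IsSig (.pair l r) e) (h : G.Occurs e c S) :
    G.Occurs l c S ∧ G.Occurs r (c + (G.val l).length) S := by
  have hl := he.uses (Or.inl rfl : Rhs.Uses (.pair l r) l)
  have hr := he.uses (Or.inr rfl : Rhs.Uses (.pair l r) r)
  exact ⟨(Occurs.left e l r l 0 he.1 he.2 (.root l hl.1)).trans h,
    (Occurs.right e l r r 0 he.1 he.2 (.root r hr.1)).trans h⟩

/-! ### Levels of the parse -/

variable (G) in
/-- `e` derives the sequence `q` of variables. -/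
def Derives (q : List ℕ) (e : ℕ) : Prop :=
  e ∈ G.vars ∧ (∀ x ∈ q, x ∈ G.vars) ∧ G.valSeq q = G.val e ∧
    ∀ c S, G.Occurs e c S → G.OccursSeq q c S

/-- One step down the parse: occurrences of a level are occurrences of the level below, at the same
positions. -/
theorem Derives.flatten {Q : List (List ℕ)} {p : List ℕ} (h : List.Forall₂ G.Derives Q p) :
    (∀ x ∈ p, x ∈ G.vars) ∧ (∀ x ∈ Q.flatten, x ∈ G.vars) ∧ G.valSeq Q.flatten = G.valSeq p ∧
      ∀ c S, G.OccursSeq p c S → G.OccursSeq Q.flatten c S := by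
  induction h with
  | nil => simp
  | cons h _ ih =>
    obtain ⟨h1, h2, h3, h4⟩ := h
    obtain ⟨i1, i2, i3, i4⟩ := ih
    refine ⟨by simpa using ⟨h1, i1⟩, ?_, by simp [h3, i3], fun c S hS => ?_⟩
    · intro x hx
      rw [List.flatten_cons, List.mem_append] at hx
      exact hx.elim (h2 x) (i2 x)
    · rw [List.flatten_cons, occursSeq_append, h3]
      rw [occursSeq_cons] at hS
      exact ⟨h4 _ _ hS.1, i4 _ _ hS.2⟩

variable (G) in
/-- `p` is the sequence of the signatures of the runs of `s`. -/
def IsPow (s p : List ℕ) : Prop :=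
  List.Forall₂ (fun r e => G.IsSig (.run r.1 r.2) e) (encpow s) p

theorem IsPow.derives {s p : List ℕ} (h : G.IsPow s p) :
    ∃ Q : List (List ℕ), Q.flatten = s ∧ List.Forall₂ G.Derives Q p := by
  refine ⟨s.splitBy (fun a b => a == b), List.flatten_splitBy _ _, ?_⟩
  rw [IsPow, encpow, List.forall₂_map_left_iff] at h
  have hQ : ∀ q ∈ s.splitBy (fun a b => a == b), q = List.replicate q.length (q.headD 0) :=
    fun q hq => eq_replicate_of_isChain (List.isChain_of_mem_splitBy hq)
  generalize s.splitBy (fun a b => a == b) = Q at *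
  induction h with
  | nil => exact .nil
  | @cons q e Q p h _ ih =>
    refine .cons ?_ (ih fun q hq => hQ q (by simp [hq]))
    have hq := hQ q (by simp)
    have hb := (h.uses (rfl : Rhs.Uses (.run (q.headD 0) q.length) _)).1
    refine ⟨h.1, fun x hx => ?_, ?_, fun c S hS => ?_⟩
    · rw [hq] at hx
      rwa [(List.mem_replicate.1 hx).2]
    · rw [val_run h, hq, valSeq, List.map_replicate, ← hq]
    · rw [hq]
      exact OccursSeq.replicate h hS

theorem IsSigBlock.derives {q : List ℕ} {e : ℕ} (h : G.IsSigBlock q e) :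
    2 ≤ q.length ∧ G.Derives q e := by
  match q, h with
  | [a, b], h =>
    have ha := (h.uses (Or.inl rfl : Rhs.Uses (.pair a b) a)).1
    have hb := (h.uses (Or.inr rfl : Rhs.Uses (.pair a b) b)).1
    refine ⟨by simp, h.1, by simp [ha, hb], by simp [val_pair h], fun i S hS => ?_⟩
    obtain ⟨h1, h2⟩ := hS.pair h
    simp only [occursSeq_cons]
    exact ⟨h1, h2, occursSeq_nil _ _⟩
  | [a, b, c], ⟨e₁, h, h'⟩ =>
    have ha := (h.uses (Or.inl rfl : Rhs.Uses (.pair a b) a)).1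
    have hb := (h.uses (Or.inr rfl : Rhs.Uses (.pair a b) b)).1
    have hc := (h'.uses (Or.inr rfl : Rhs.Uses (.pair e₁ c) c)).1
    refine ⟨by simp, h'.1, by simp [ha, hb, hc], by simp [val_pair h, val_pair h'],
      fun i S hS => ?_⟩
    obtain ⟨h1, h2⟩ := hS.pair h'
    obtain ⟨h3, h4⟩ := h1.pair h
    rw [val_pair h, List.length_append, ← Nat.add_assoc] at h2
    simp only [occursSeq_cons]
    exact ⟨h3, h4, h2, occursSeq_nil _ _⟩
  | [a, b, c, d], ⟨e₁, e₂, h, h', h''⟩ =>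
    have ha := (h.uses (Or.inl rfl : Rhs.Uses (.pair a b) a)).1
    have hb := (h.uses (Or.inr rfl : Rhs.Uses (.pair a b) b)).1
    have hc := (h'.uses (Or.inr rfl : Rhs.Uses (.pair e₁ c) c)).1
    have hd := (h''.uses (Or.inr rfl : Rhs.Uses (.pair e₂ d) d)).1
    refine ⟨by simp, h''.1, by simp [ha, hb, hc, hd],
      by simp [val_pair h, val_pair h', val_pair h''], fun i S hS => ?_⟩
    obtain ⟨h0, h5⟩ := hS.pair h''
    obtain ⟨h1, h2⟩ := h0.pair h'
    obtain ⟨h3, h4⟩ := h1.pair h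
    rw [val_pair h', val_pair h] at h5
    rw [val_pair h] at h2
    simp only [List.length_append, ← Nat.add_assoc] at h2 h5
    simp only [occursSeq_cons]
    exact ⟨h3, h4, h2, h5, occursSeq_nil _ _⟩

theorem IsSigBlock.unique {q : List ℕ} {e e' : ℕ} (h : G.IsSigBlock q e)
    (h' : G.IsSigBlock q e') : e = e' := by
  match q, h, h' with
  | [a, b], h, h' => exact IsSig.unique h h'
  | [a, b, c], ⟨e₁, h1, h2⟩, ⟨e₁', h1', h2'⟩ =>
    obtain rfl := h1.unique h1'
    exact h2.unique h2'
  | [a, b, c, d], ⟨e₁, e₂, h1, h2, h3⟩, ⟨e₁', e₂', h1', h2', h3'⟩ =>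
    obtain rfl := h1.unique h1'
    obtain rfl := h2.unique h2'
    exact h3.unique h3'

theorem forall₂_unique {β γ : Type*} {R : β → γ → Prop} (hR : ∀ a b c, R a b → R a c → b = c)
    {l : List β} {m m' : List γ} (h : List.Forall₂ R l m) (h' : List.Forall₂ R l m') : m = m' := by
  induction h generalizing m' with
  | nil => cases h'; rfl
  | cons h _ ih =>
    cases h' with
    | cons h1 h2 => rw [hR _ _ _ h h1, ih h2]

theorem IsPow.unique {s p p' : List ℕ} (h : G.IsPow s p) (h' : G.IsPow s p') : p = p' :=
  forall₂_unique (R := fun (r : ℕ × ℕ) e => G.IsSig (.run r.1 r.2) e)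
    (fun _ _ _ h h' => IsSig.unique h h') h h'

theorem forall₂_append_left {β γ : Type*} {R : β → γ → Prop} {l l' : List β} {m : List γ}
    (h : List.Forall₂ R (l ++ l') m) :
    ∃ k k', m = k ++ k' ∧ List.Forall₂ R l k ∧ List.Forall₂ R l' k' := by
  induction l generalizing m with
  | nil => exact ⟨[], m, rfl, .nil, h⟩
  | cons a l ih =>
    cases h with
    | cons h1 h2 =>
      obtain ⟨k, k', rfl, h3, h4⟩ := ih h2
      exact ⟨_ :: k, k', rfl, .cons h1 h3, h4⟩

theorem IsPow.append {u w p : List ℕ} (hj : Junction u w) (h : G.IsPow (u ++ w) p) :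
    ∃ k k', p = k ++ k' ∧ G.IsPow u k ∧ G.IsPow w k' := by
  rw [IsPow, encpow_append hj] at h
  exact forall₂_append_left h

/-- Equal neighbours would have the same production, hence adjacent maximal runs with the same base.
-/
theorem IsPow.isColored {s p : List ℕ} {W : ℕ} (hW : ∀ e ∈ G.vars, e ≤ W) (h : G.IsPow s p) :
    IsColored W p := by
  refine ⟨?_, fun a ha => ?_⟩
  · have hc := encpow_isChain s
    rw [IsPow] at h
    generalize encpow s = l at *
    induction h with
    | nil => simp
    | @cons r e l p h h2 ih =>
      rw [List.isChain_cons] at hc ⊢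
      refine ⟨fun y hy => ?_, ih hc.2⟩
      rintro rfl
      cases h2 with
      | nil => simp at hy
      | @cons r' e' l p h' _ =>
        simp only [List.head?_cons, Option.mem_def, Option.some.injEq] at hy
        subst hy
        have := h.2.symm.trans h'.2
        simp only [Rhs.run.injEq] at this
        exact hc.1 r' (by simp) this.1
  · obtain ⟨Q, -, hQ⟩ := h.derives
    exact hW a ((Derives.flatten hQ).1 a ha)

theorem IsPow.length_eq {s p : List ℕ} (h : G.IsPow s p) : p.length = runs s := by
  rw [← length_encpow]
  exact (List.Forall₂.length_eq h).symm

variable (G) in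
/-- The levels of the parse of `T`. -/
structure IsParse {W : ℕ} (f : (Fin (logStar W + 11) → Option ℕ) → Bool) (T : List α) (S h : ℕ)
    (shrink pow : ℕ → List ℕ) : Prop where
  term : List.Forall₂ (fun a e => G.IsSig (.term a) e) T (shrink 0)
  run : ∀ t ≤ h, G.IsPow (shrink t) (pow t)
  block : ∀ t < h, List.Forall₂ G.IsSigBlock (eblock f (pow t)) (shrink (t + 1))
  last : pow h = [S]

theorem IsId.exists_isParse {W : ℕ} {f : (Fin (logStar W + 11) → Option ℕ) → Bool} {T : List α}
    {S : ℕ} (h : G.IsId f T S) : ∃ h shrink pow, G.IsParse f T S h shrink pow := by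
  obtain ⟨h, shrink, pow, h1, h2, h3, -, h5⟩ := h
  exact ⟨h, shrink, pow, h1, h2, h3, h5⟩

theorem flatten_eblock {W : ℕ} (f : (Fin (logStar W + 11) → Option ℕ) → Bool) (p : List ℕ) :
    (eblock f p).flatten = p := by
  change (cut (withBits f p)).flatten = p
  rw [flatten_cut, map_fst_withBits]

theorem IsPow.flatten {s p : List ℕ} (h : G.IsPow s p) :
    (∀ x ∈ p, x ∈ G.vars) ∧ (∀ x ∈ s, x ∈ G.vars) ∧ G.valSeq s = G.valSeq p ∧
      ∀ c S, G.OccursSeq p c S → G.OccursSeq s c S := by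
  obtain ⟨Q, rfl, hQ⟩ := h.derives
  exact Derives.flatten hQ

theorem forall₂_isSigBlock {Q : List (List ℕ)} {p : List ℕ} (h : List.Forall₂ G.IsSigBlock Q p) :
    (∀ x ∈ p, x ∈ G.vars) ∧ (∀ x ∈ Q.flatten, x ∈ G.vars) ∧ G.valSeq Q.flatten = G.valSeq p ∧
      ∀ c S, G.OccursSeq p c S → G.OccursSeq Q.flatten c S :=
  Derives.flatten (h.imp fun _ _ h => h.derives.2)

theorem forall₂_isSigBlock_length {Q : List (List ℕ)} {p : List ℕ}
    (h : List.Forall₂ G.IsSigBlock Q p) : 2 * p.length ≤ Q.flatten.length := by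
  induction h with
  | nil => simp
  | cons h _ ih =>
    have := h.derives.1
    simp only [List.length_cons, List.flatten_cons, List.length_append]
    omega

/-- Descent from the top level `[S]`, which occurs at the root. -/
theorem IsParse.occursSeq {W : ℕ} {f : (Fin (logStar W + 11) → Option ℕ) → Bool} {T : List α}
    {S h : ℕ} {shrink pow : ℕ → List ℕ} (hp : G.IsParse f T S h shrink pow) {t : ℕ} (ht : t ≤ h) :
    G.OccursSeq (pow t) 0 S ∧ G.valSeq (pow t) = G.val S := by
  induction ht using Nat.decreasingInduction with
  | self =>
    have hS : S ∈ G.vars := (hp.run h le_rfl).flatten.1 S (by rw [hp.last]; simp)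
    rw [hp.last, occursSeq_cons]
    exact ⟨⟨.root S hS, occursSeq_nil _ _⟩, by simp⟩
  | of_succ t ht ih =>
    obtain ⟨-, -, h1, h2⟩ := (hp.run (t + 1) ht).flatten
    obtain ⟨-, -, h3, h4⟩ := forall₂_isSigBlock (hp.block t ht)
    rw [flatten_eblock] at h3 h4
    exact ⟨h4 _ _ (h2 _ _ ih.1), by rw [h3, h1, ih.2]⟩

theorem IsParse.occursSeq_shrink {W : ℕ} {f : (Fin (logStar W + 11) → Option ℕ) → Bool}
    {T : List α} {S h : ℕ} {shrink pow : ℕ → List ℕ} (hp : G.IsParse f T S h shrink pow) {t : ℕ}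
    (ht : t ≤ h) : G.OccursSeq (shrink t) 0 S :=
  (hp.run t ht).flatten.2.2.2 _ _ (hp.occursSeq ht).1

theorem valSeq_of_forall₂_term {T : List α} {s : List ℕ}
    (h : List.Forall₂ (fun a e => G.IsSig (.term a) e) T s) : G.valSeq s = T := by
  induction h with
  | nil => rfl
  | cons h _ ih => rw [valSeq_cons, val_term h, ih]; rfl

theorem IsParse.val_eq {W : ℕ} {f : (Fin (logStar W + 11) → Option ℕ) → Bool}
    {T : List α} {S h : ℕ} {shrink pow : ℕ → List ℕ} (hp : G.IsParse f T S h shrink pow) :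
    G.val S = T := by
  rw [← (hp.occursSeq (Nat.zero_le h)).2, ← (hp.run 0 (Nat.zero_le h)).flatten.2.2.1,
    valSeq_of_forall₂_term hp.term]

/-- Every variable occurs in the derivation tree of some text. -/
theorem IsSignatureEncoding.exists_occurs {W : ℕ}
    {f : (Fin (logStar W + 11) → Option ℕ) → Bool} {𝒯 : Set (List α)}
    (hG : G.IsSignatureEncoding f 𝒯) {e : ℕ} (he : e ∈ G.vars) :
    ∃ T ∈ 𝒯, ∃ S c, G.IsId f T S ∧ G.Occurs e c S := by
  obtain ⟨hW, -, h⟩ := hG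
  -- A variable is smaller than those whose productions use it, so climbing to such variables stops,
  -- since all are at most `W`.
  obtain ⟨n, hn⟩ : ∃ n, W < n + e := ⟨W + 1, by omega⟩
  induction n generalizing e with
  | zero => have := hW e he; omega
  | succ n ih =>
    rcases h e he with ⟨T, hT, hid⟩ | ⟨e', he', hu⟩
    · exact ⟨T, hT, e, 0, hid, .root e he⟩
    · have hlt := (G.uses_mem e' he' e hu).2
      obtain ⟨T, hT, S, c, hid, ho⟩ := ih he' (by omega)
      have : ∃ d, G.Occurs e d e' := by
        rcases hr : G.prod e' with a | ⟨l, r⟩ | ⟨b, k⟩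
        · rw [hr] at hu; exact hu.elim
        · rw [hr] at hu
          rcases hu with rfl | rfl
          · exact ⟨_, .left _ _ _ _ _ he' hr (.root _ he)⟩
          · exact ⟨_, .right _ _ _ _ _ he' hr (.root _ he)⟩
        · rw [hr] at hu
          obtain rfl : e = b := hu
          exact ⟨_, .run _ _ _ 0 _ _ he' hr (G.run_pos e' he' e k hr) (.root _ he)⟩
      obtain ⟨d, hd⟩ := this
      exact ⟨T, hT, S, _, hid, hd.trans ho⟩

end

end RLGrammar

end SigEnc

/-! ### Construction of the common sequence -/

namespace SigEnc

namespace RLGrammar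

variable {α : Type u} {G : RLGrammar α}

/-- If `L` and `R` are the first and the last run of `L ++ M ++ R`, then the signatures of the runs of
`M` are contiguous in the signatures of the runs of any sequence containing `L ++ M ++ R`. -/
theorem IsPow.inner {L M R : List ℕ} (hL : L ≠ []) (hR : R ≠ []) (h1 : Junction L (M ++ R))
    (h2 : Junction M R) {a b p : List ℕ} (h : G.IsPow (a ++ (L ++ M ++ R) ++ b) p) :
    ∃ A Y B, p = A ++ Y ++ B ∧ G.IsPow (a ++ L) A ∧ G.IsPow M Y ∧ G.IsPow (R ++ b) B := by
  rw [show a ++ (L ++ M ++ R) ++ b = a ++ L ++ (M ++ (R ++ b)) by simp] at h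
  have j1 : Junction (a ++ L) (M ++ (R ++ b)) := by
    rw [← List.append_assoc M]
    exact (h1.append_left hL a).append_right (by simp [hR]) b
  obtain ⟨A, k, rfl, hA, hk⟩ := h.append j1
  obtain ⟨Y, B, rfl, hY, hB⟩ := hk.append (h2.append_right hR b)
  exact ⟨A, Y, B, by simp, hA, hY, hB⟩

/-- Induction on the length of `X`, with the level `t` varying. The parse of `T₀` serves to find `Y`
and `X'`; by uniqueness of signatures all other parses produce the same ones. The alternative `2 ≤
v.length ∨ v = X` is needed at level `0`, to pass from texts to arbitrary variables. -/
theorem exists_common_seq {W : ℕ} {f : (Fin (logStar W + 11) → Option ℕ) → Bool}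
    (hf : IsLocallyConsistent W f) (hW : ∀ e ∈ G.vars, e ≤ W) (n : ℕ) :
    ∀ (X : List ℕ) (t : ℕ) (T₀ : List α) (S₀ h₀ : ℕ) (shrink₀ pow₀ : ℕ → List ℕ),
      X.length ≤ n → X ≠ [] → G.IsParse f T₀ S₀ h₀ shrink₀ pow₀ → t ≤ h₀ → X <:+: shrink₀ t →
      ∃ v : List ℕ, (∀ x ∈ v, x ∈ G.vars) ∧ (2 ≤ v.length ∨ v = X) ∧
        G.valSeq v = G.valSeq X ∧ runs v ≤ (logStar W + 20) * (Nat.log 2 X.length + 1) ∧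
        ∀ (T : List α) (S h : ℕ) (shrink pow : ℕ → List ℕ), G.IsParse f T S h shrink pow →
          t ≤ h → ∀ a b, shrink t = a ++ X ++ b → G.OccursSeq v (G.valSeq a).length S := by
  induction n with
  | zero => 
    intro X _ _ _ _ _ _ hn hX
    exact absurd (List.length_eq_zero_iff.1 (by omega)) hX
  | succ n ih =>
    intro X t T₀ S₀ h₀ shrink₀ pow₀ hn hX hp₀ ht₀ hX₀
    have hXv : ∀ x ∈ X, x ∈ G.vars := fun x hx =>
      (hp₀.run t ht₀).flatten.2.1 x (hX₀.subset hx)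
    -- Beyond this threshold, dropping the two outer runs leaves at least `log* W + 19` signatures,
    -- enough for `exists_boundaries`.
    by_cases hsmall : runs X ≤ logStar W + 20
    · refine ⟨X, hXv, Or.inr rfl, rfl, hsmall.trans (Nat.le_mul_of_pos_right _ (by omega)), ?_⟩
      intro T S h shrink pow hp ht a b hab
      have := hp.occursSeq_shrink ht
      rw [hab] at this
      exact this.infix
    rcases exists_outer_runs hX with ⟨k, a, rfl⟩ | ⟨k, c, m, d, M, hXeq, hj1, hj2⟩
    · have := runs_replicate_le k a
      omega
    have hLr := runs_replicate_le (k + 1) c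
    have hRr := runs_replicate_le (m + 1) d
    have hLne : List.replicate (k + 1) c ≠ [] := by simp
    have hRne : List.replicate (m + 1) d ≠ [] := by simp
    generalize List.replicate (k + 1) c = L at *
    generalize List.replicate (m + 1) d = R at *
    subst hXeq
    have hinner := fun a b p (h : G.IsPow (a ++ (L ++ M ++ R) ++ b) p) =>
      IsPow.inner hLne hRne hj1 hj2 h
    obtain ⟨a₀, b₀, hab₀⟩ := hX₀
    have hrun₀ := hp₀.run t ht₀
    rw [← hab₀] at hrun₀
    obtain ⟨A₀, Y, B₀, hpow₀, hA₀, hY, -⟩ := hinner _ _ _ hrun₀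
    have hYlen := hY.length_eq
    have hruns := (runs_append_le (L ++ M) R).trans (Nat.add_le_add_right (runs_append_le L M) _)
    have hMlen := runs_le_length M
    -- A parse whose level `t` contains `Y` cannot end there, as its last level has a single entry.
    have hlt : ∀ {T : List α} {S h : ℕ} {shrink pow : ℕ → List ℕ},
        G.IsParse f T S h shrink pow → t ≤ h → ∀ {A B}, pow t = A ++ Y ++ B → t < h := by
      intro T S h shrink pow hp ht A B hpow
      refine lt_of_le_of_ne ht ?_
      rintro rfl
      rw [hp.last] at hpow
      have := congrArg List.length hpow
      simp only [List.length_append, List.length_singleton] at this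
      omega
    obtain ⟨i, m, hi1, hi2, hm, him, hlast, hbi, hbm⟩ :=
      exists_boundaries hf (hY.isColored hW) (by omega)
    obtain ⟨Q, hQ, hblocks⟩ := exists_blocks f hi1 him hbi hbm
    have hYsplit : Y = Y.take i ++ Q.flatten ++ Y.drop (i + m) := by
      rw [hQ, List.append_assoc, ← List.drop_drop, List.take_append_drop, List.take_append_drop]
    have hnext : ∀ {T : List α} {S h : ℕ} {shrink pow : ℕ → List ℕ},
        G.IsParse f T S h shrink pow → t ≤ h → ∀ {A B}, pow t = A ++ Y ++ B →
        ∃ A' X' B', shrink (t + 1) = A' ++ X' ++ B' ∧ List.Forall₂ G.IsSigBlock Q X' ∧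
          G.valSeq A' = G.valSeq (A ++ Y.take i) := by
      intro T S h shrink pow hp ht A B hpow
      have hb := hp.block t (hlt hp ht hpow)
      obtain ⟨QA, QB, h1, h2, h3⟩ := hblocks A B
      rw [hpow, h1] at hb
      obtain ⟨k, B', h4, hk, hB'⟩ := forall₂_append_left hb
      obtain ⟨A', X', h5, hA', hX'⟩ := forall₂_append_left hk
      exact ⟨A', X', B', by rw [h4, h5], hX', by rw [← h2, (forall₂_isSigBlock hA').2.2.1]⟩
    obtain ⟨A', X', B', hshrink₀, hX', -⟩ := hnext hp₀ ht₀ hpow₀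
    have hX'len := forall₂_isSigBlock_length hX'
    obtain ⟨-, -, hX'val, -⟩ := forall₂_isSigBlock hX'
    have hQlen : Q.flatten.length = m := by
      rw [hQ, List.length_take, List.length_drop]
      omega
    have hX'ne : X' ≠ [] := by
      rintro rfl
      cases hX'
      simp at hQlen
      omega
    have hXlen : (L ++ M ++ R).length = L.length + M.length + R.length := by
      simp only [List.length_append]
    have hX'pos := List.length_pos_of_ne_nil hX'ne
    obtain ⟨v', hv1, -, hv3, hv4, hv5⟩ := ih X' (t + 1) T₀ S₀ h₀ shrink₀ pow₀ (by omega) hX'ne hp₀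
      (hlt hp₀ ht₀ hpow₀) ⟨A', B', hshrink₀.symm⟩
    have hYv := hY.flatten
    -- Blocks have at least two entries, so `2|X'| ≤ m ≤ |Y| ≤ |M|`.
    have hlog : Nat.log 2 X'.length + 1 ≤ Nat.log 2 (L ++ M ++ R).length := by
      rw [← Nat.log_mul_base (by norm_num) (by omega)]
      exact Nat.log_mono_right (by omega)
    have hLpos := List.length_pos_of_ne_nil hLne
    have hRpos := List.length_pos_of_ne_nil hRne
    -- Besides `v'` there are at most `1 + (log* W + 9) + 8 + 1` runs. The outer pieces come from
    -- `Shrink_t`, the pieces of `Y` from `Pow_t`, and `v'` from higher levels.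
    refine ⟨L ++ Y.take i ++ v' ++ Y.drop (i + m) ++ R, ?_, ?_, ?_, ?_, ?_⟩
    · intro x hx
      simp only [List.mem_append] at hx hXv
      rcases hx with (((hx | hx) | hx) | hx) | hx
      · exact hXv x (Or.inl (Or.inl hx))
      · exact hYv.1 x (List.mem_of_mem_take hx)
      · exact hv1 x hx
      · exact hYv.1 x (List.mem_of_mem_drop hx)
      · exact hXv x (Or.inr hx)
    · left
      simp only [List.length_append]
      omega
    · have h1 := congrArg G.valSeq hYsplit
      simp only [valSeq_append] at h1 ⊢
      rw [hv3, ← hX'val, hYv.2.2.1, h1]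
      simp
    · have r1 := runs_append_le (L ++ Y.take i ++ v' ++ Y.drop (i + m)) R
      have r2 := runs_append_le (L ++ Y.take i ++ v') (Y.drop (i + m))
      have r3 := runs_append_le (L ++ Y.take i) v'
      have r4 := runs_append_le L (Y.take i)
      have r5 := runs_le_length (Y.take i)
      have r6 := runs_le_length (Y.drop (i + m))
      rw [List.length_take] at r5
      rw [List.length_drop] at r6
      have r7 := Nat.mul_le_mul_left (logStar W + 20) hlog
      rw [Nat.mul_add_one]
      omega
    · intro T S h shrink pow hp ht a b hab
      have hrun := hp.run t ht
      rw [hab] at hrun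
      obtain ⟨A, Y', B, hpow, hA, hY', -⟩ := hinner _ _ _ hrun
      obtain rfl := hY.unique hY'
      obtain ⟨A'', X'', B'', hshrink, hX'', hA''⟩ := hnext hp ht hpow
      obtain rfl := forall₂_unique (R := G.IsSigBlock) (fun _ _ _ h h' => h.unique h') hX' hX''
      have o1 := hv5 T S h shrink pow hp (hlt hp ht hpow) A'' B'' hshrink
      have o2 := (hp.occursSeq ht).1
      rw [hpow] at o2
      have o2 := o2.infix
      rw [hYsplit] at o2
      have o3 := hp.occursSeq_shrink ht
      rw [hab] at o3
      have o3 := o3.infix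
      have e1 := hA.flatten.2.2.1
      have e2 := congrArg G.valSeq hYsplit
      rw [← hYv.2.2.1] at e2
      simp only [valSeq_append] at e2
      have e2 := congrArg List.length e2
      rw [hA'', valSeq_append, ← e1] at o1
      rw [← e1] at o2
      simp only [occursSeq_append, valSeq_append, List.length_append] at o1 o2 o3 e2 ⊢
      rw [hv3, ← hX'val]
      refine ⟨⟨⟨⟨o3.1.1, o2.1.1⟩, ?_⟩, ?_⟩, ?_⟩
      · convert o1 using 1
        omega
      · convert o2.2 using 1
        omega
      · convert o3.2 using 1
        omega

/-! ### From texts to arbitrary variables -/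

theorem infix_of_forall₂ {β γ : Type*} {R : β → γ → Prop} {x P y : List β} {s : List γ}
    (h : List.Forall₂ R (x ++ P ++ y) s) :
    ∃ a X b, s = a ++ X ++ b ∧ List.Forall₂ R x a ∧ List.Forall₂ R P X := by
  obtain ⟨k, b, rfl, hk, -⟩ := forall₂_append_left h
  obtain ⟨a, X, rfl, ha, hX⟩ := forall₂_append_left hk
  exact ⟨a, X, b, rfl, ha, hX⟩

/-- An occurrence of a sequence in a variable `S` inside of the leaves of a node `e` is an
occurrence in `e`. -/
theorem OccursSeq.nested {v : List ℕ} {e c d S : ℕ} (he : G.Occurs e c S)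
    (hv : G.OccursSeq v (c + d) S) (hd : d + (G.valSeq v).length ≤ (G.val e).length)
    (hlen : 2 ≤ v.length ∨ ∀ x ∈ v, ∃ a, G.prod x = .term a) : G.OccursSeq v d e := by
  intro j hj
  have hx := hv j hj
  have hvar : ∀ x ∈ v, x ∈ G.vars := by
    intro x hx
    obtain ⟨k, hk, rfl⟩ := List.getElem_of_mem hx
    exact (hv k hk).mem.1
  have hsplit : v = v.take j ++ v[j] :: v.drop (j + 1) := by
    rw [List.getElem_cons_drop, List.take_append_drop]
  have hval := congrArg (fun w => (G.valSeq w).length) hsplit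
  -- Every other entry of `v` derives at least one character, so with two entries `v[j]` derives
  -- strictly less than `e`.
  have l1 := length_le_valSeq (fun x hx => hvar x (List.mem_of_mem_take hx) :
    ∀ x ∈ v.take j, x ∈ G.vars)
  have l2 := length_le_valSeq (fun x hx => hvar x (List.mem_of_mem_drop hx) :
    ∀ x ∈ v.drop (j + 1), x ∈ G.vars)
  rw [List.length_take] at l1
  rw [List.length_drop] at l2
  simp only [valSeq_append, valSeq_cons, List.length_append] at hval
  have := he.nested hx (by omega) (by omega) ?_
  · rwa [Nat.add_assoc, Nat.add_sub_cancel_left] at this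
  · rcases hlen with h | h
    · left
      omega
    · exact Or.inr (h _ (List.getElem_mem hj))

/-- The case `t = 0`, where `X` consists of the signatures of the characters of `P`. An occurrence
of `P` in `val(e)` is moved to a text containing `e`, and the resulting occurrence of `v` is pulled
back to `e`. -/
theorem IsSignatureEncoding.exists_common_seq {W : ℕ}
    {f : (Fin (logStar W + 11) → Option ℕ) → Bool} (hf : IsLocallyConsistent W f)
    {𝒯 : Set (List α)} (hG : G.IsSignatureEncoding f 𝒯) {P : List α} (hP : P ≠ [])
    (hPT : ∃ T ∈ 𝒯, P <:+: T) :
    ∃ v : List ℕ, (∀ x ∈ v, x ∈ G.vars) ∧ G.valSeq v = P ∧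
      (encpow v).length ≤ (logStar W + 20) * (Nat.log 2 P.length + 1) ∧
      ∀ e ∈ G.vars, ∀ x y : List α, G.val e = x ++ P ++ y → G.OccursSeq v x.length e := by
  obtain ⟨T₀, hT₀, x₀, y₀, rfl⟩ := hPT
  obtain ⟨S₀, hS₀⟩ := hG.2.1 _ hT₀
  obtain ⟨h₀, shrink₀, pow₀, hp₀⟩ := hS₀.exists_isParse
  obtain ⟨a₀, X, b₀, hs₀, ha₀, hX⟩ := infix_of_forall₂ hp₀.term
  have hlen := hX.length_eq
  have hXval := valSeq_of_forall₂_term hX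
  have hXne : X ≠ [] := by rintro rfl; cases hX; exact hP rfl
  obtain ⟨v, hv1, hv2, hv3, hv4, hv5⟩ := RLGrammar.exists_common_seq hf hG.1 X.length X 0 _ S₀ h₀
    shrink₀ pow₀ le_rfl hXne hp₀ (Nat.zero_le _) ⟨a₀, b₀, hs₀.symm⟩
  refine ⟨v, hv1, hv3.trans hXval, by rwa [length_encpow, hlen], fun e he x y hxy => ?_⟩
  obtain ⟨T, -, S, c, hS, ho⟩ := hG.exists_occurs he
  obtain ⟨h, shrink, pow, hp⟩ := hS.exists_isParse
  obtain ⟨u, w, huw, hu⟩ := ho.val_eq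
  have hT := hp.term
  rw [← hp.val_eq, huw, hxy,
    show u ++ (x ++ P ++ y) ++ w = (u ++ x) ++ P ++ (y ++ w) by simp] at hT
  obtain ⟨a, X', b, hs, ha, hX'⟩ := infix_of_forall₂ hT
  obtain rfl := forall₂_unique (R := fun a e => G.IsSig (.term a) e)
    (fun _ _ _ h h' => h.unique h') hX hX'
  have hv := hv5 T S h shrink pow hp (Nat.zero_le _) a b hs
  rw [valSeq_of_forall₂_term ha, List.length_append, hu] at hv
  refine hv.nested ho ?_ (hv2.imp_right ?_)
  · rw [hv3, hXval, hxy]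
    simp
  · rintro rfl z hz
    obtain ⟨i, hi, rfl⟩ := List.getElem_of_mem hz
    exact ⟨_, (hX.get (hlen ▸ hi) hi).2⟩

end RLGrammar

end SigEnc

/-! ### The bound in terms of `log* M` -/

theorem mainTheorem7 (K : ℕ) :
    ∃ C : ℝ, ∀ (α : Type u) (M W : ℕ) (f : (Fin (SigEnc.logStar W + 11) → Option ℕ) → Bool)
      (𝒯 : Set (List α)) (G : SigEnc.RLGrammar α) (P : List α),
      W ≤ K * M → SigEnc.IsLocallyConsistent W f →
      (∀ T ∈ 𝒯, T.length ≤ M) → G.IsSignatureEncoding f 𝒯 →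
      P ≠ [] → (∃ T ∈ 𝒯, P <:+: T) →
      ∃ v : List ℕ, (∀ x ∈ v, x ∈ G.vars) ∧
        G.valSeq v = P ∧
        (2 ≤ P.length →
          ((SigEnc.encpow v).length : ℝ) ≤
            C * (Real.logb 2 (P.length : ℝ) * (SigEnc.logStar M : ℝ))) ∧
        ∀ e ∈ G.vars, ∀ x y : List α, G.val e = x ++ P ++ y → G.OccursSeq v x.length e := by
  -- The factor `log* K + 22` absorbs `log* W + 20 ≤ log* K + log* M + 21`, using `log* M ≥ 1`; the
  -- factor `2` absorbs the `+ 1` next to `Nat.log 2 |P| ≥ 1`. Both need `|P| ≥ 2`.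
  refine ⟨2 * (SigEnc.logStar K + 22), fun α M W f 𝒯 G P hWK hf hM hG hP hPT => ?_⟩
  obtain ⟨v, h1, h2, h3, h4⟩ := hG.exists_common_seq hf hP hPT
  refine ⟨v, h1, h2, fun hlen => ?_, h4⟩
  obtain ⟨T, hT, hPT⟩ := hPT
  have hM1 := SigEnc.one_le_logStar (hlen.trans (hPT.length_le.trans (hM T hT)))
  have hW : SigEnc.logStar W + 20 ≤ (SigEnc.logStar K + 22) * SigEnc.logStar M := by
    have := SigEnc.logStar_mul_le hWK
    have hmax : max (SigEnc.logStar K) (SigEnc.logStar M) ≤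
      SigEnc.logStar K + SigEnc.logStar M := by omega
    nlinarith
  have hlog1 : 1 ≤ Nat.log 2 P.length := Nat.log_pos (by norm_num) hlen
  have hlog2 : (Nat.log 2 P.length : ℝ) ≤ Real.logb 2 P.length := by
    exact_mod_cast Real.natLog_le_logb P.length 2
  have h5 : (SigEnc.encpow v).length ≤
      (SigEnc.logStar K + 22) * SigEnc.logStar M * (2 * Nat.log 2 P.length) :=
    h3.trans (Nat.mul_le_mul hW (by omega))
  have h6 : ((SigEnc.encpow v).length : ℝ) ≤
      (SigEnc.logStar K + 22) * SigEnc.logStar M * (2 * Nat.log 2 P.length) := by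
    exact_mod_cast h5
  refine h6.trans ?_
  calc ((SigEnc.logStar K : ℝ) + 22) * SigEnc.logStar M * (2 * Nat.log 2 P.length)
      ≤ (SigEnc.logStar K + 22) * SigEnc.logStar M * (2 * Real.logb 2 P.length) := by gcongr
    _ = _ := by ring
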